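/- **Notation.** $\mathbb N=\{0,1,2,\dots\}$, $\mathbb Z_2$ is the group with two elements, $\lambda(m)\in\{0,1\}$ is the residue of $m$ modulo $2$, and $f_0=f_1=1$, $f_i=f_{i-1}+f_{i-2}$. $F(n)$ is the number of finite sets of Fibonacci numbers $f_i$ $(i\ge1)$ with sum $n$ (so $F(0)=1$). A *2-partition* is a finite set $I=\{i_1<\dots<i_q\}$ of positive integers with $i_{a+1}-i_a\ge 2$; put $f_I=\sum_a f_{i_a}$. By Zeckendorf's theorem $I\mapsto f_I$ is a bijection from the set $\mathcal P_2$ of 2-partitions to $\mathbb N$; let $Z$ be its inverse. *The map $\mathcal V$.* For $I\in\mathcal P_2$ let $\alpha_1=\lfloor (i_1-1)/2\rfloor+1$ and $\alpha_r=\lfloor (i_r-i_{r-1})/2\rfloor+1$ for $r>1$. Cut $I$ into its maximal runs of consecutive parts of equal parity, and cut $(\alpha_1,\dots,\alpha_q)$ into blocks $A_1,\dots,A_s$ of the same lengths; $\mathcal V(I)=A_1\times\dots\times A_s$ (empty if $I=\emptyset$). *The maps $p,\pi,\delta$.* Let $\Gamma(\mathbb Q/\mathbb Z)$ be the free monoid,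 with product $*$ and unit $1$, on the nonzero elements of $\mathbb Q/\mathbb Z$, written as reduced fractions $a/b\in(0,1)$. Put $\langle\alpha_1,\dots,\alpha_q\rangle=\cfrac{1}{\alpha_1-\cfrac{1}{\alpha_2-\dots-\cfrac1{\alpha_q}}}$, let $p(A_1\times\dots\times A_s)=(\langle A_1\rangle-\lfloor\langle A_1\rangle\rfloor)*\langle A_2\rangle*\dots*\langle A_s\rangle$ (a zero first factor is omitted; $p$ of the empty multivector is $1$), and let $\pi=p\circ\mathcal V\circ Z:\mathbb N\to\Gamma(\mathbb Q/\mathbb Z)$. Let $\delta:\Gamma(\mathbb Q/\mathbb Z)\to\mathbb N_*$ (the positive integers under multiplication) be the homomorphism $\delta(a_1/b_1*\dots*a_s/b_s)=b_1\cdots b_s$. *The map $\theta$.* For a reduced fraction $g=a/b\in(0,1)$ let $c(g)=(\alpha_1,\alpha_2,\dots)$ be the vector with $\langle c(g)\rangle=g$ given by $a_1=a$, $b_1=b$, $\alpha_i=\lceil b_i/a_i\rceil$, $a_{i+1}=a_i\alpha_i-b_i$, $b_{i+1}=a_i$, stopping when $a_{i+1}=0$; put $c(g_1*\dots*g_s)=c(g_1)\times\dots\times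 c(g_s)$. Let $\theta(\gamma)=f_I$, where $I$ is the 2-partition with $\mathcal V(I)=c(\gamma)$ whose lowest part is odd ($\theta(1)=0$). *The maps $\omega,S,\tau$*, defined on $\mathcal P_2$ and carried over to $\mathbb N$ by $Z$. For $I=\{i_1<\dots<i_q\}\ne\emptyset$: $\omega(I)=\{i_1+1,\dots,i_q+1\}$ if $i_1$ is odd, and $\{i_1-1,\dots,i_q-1\}$ if $i_1$ is even; $S(I)=\{2-\lambda(i_1),i_1+2,\dots,i_q+2\}$. Every nonempty $I$ is uniquely $S^r(I')$ with $r\ge0$ and $I'$ nonempty and not of the form $S(J)$, $J\neq\emptyset$; put $\tau(I)=S^r(\tau(I'))$, where $\tau(\{i_1,\dots,i_q\})=\{2-\lambda(i_1),i_1+1,\dots,i_q+1\}$ if $i_1\ge3$, $\tau(\{1,i_1,\dots,i_q\})=\{i_1-1,\dots,i_q-1\}$ if $i_1\ge3$ is even, $\tau(\{2,i_1,\dots,i_q\})=\{i_1-1,\dots,i_q-1\}$ if $i_1\ge3$ is odd, and, as a convention, $\tau(\{1\})=\{1\}$, $\tau(\{2\})=\{2\}$. By convention $\omega,S,\tau$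 fix $\emptyset$. Call $n\in\mathbb N$ *regular* if it is not of the form $f_r-1$ with $r\ge1$. **Theorem 2.5.** Let $\mathbb T$ be the monoid of maps $\mathbb N\to\mathbb N$ generated under composition by $\omega,\tau,S$, acting on $\mathbb N$; the orbits of $\mathbb T$ are the classes of the equivalence relation generated by $n\sim t(n)$, $t\in\mathbb T$. 1. There is an isomorphism $\mathbb Z_2\times\mathbb Z_2\times\mathbb N\cong\mathbb T$ sending the standard generators to $\omega,\tau,S$. The action is free at regular numbers: if $n$ is regular, $s,t\in\mathbb T$ and $s(n)=t(n)$, then $s=t$. 2. For every $\gamma\in\Gamma(\mathbb Q/\mathbb Z)$ the number $\theta(\gamma)$ exists and is the least element of $\pi^{-1}(\gamma)$. For each orbit $x$ of a regular number there is a unique $\gamma(x)\in\Gamma(\mathbb Q/\mathbb Z)$ with $x=\mathbb T(\theta(\gamma(x)))$, and $x\mapsto\gamma(x)$ is a bijection from the set of orbits of regular numbers to $\Gamma(\mathbb Q/\mathbb Z)\setminus\{1\}$. 3. The natural projection, which sends a regular number to $\gamma$ of its orbit, is $\pi=p\circ\mathcal V\circ Z$. The remaining fibre is $\pi^{-1}(1)=\{f_r-1: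 r\ge1\}$. 4. For all $t\in\mathbb T$ and $n\in\mathbb N$: $\pi(t(n))=\pi(n)$ and $F(t(n))=F(n)$; and $F=\delta\circ\pi$ on $\mathbb N$. -/

import Mathlib

namespace FibPart

/-- The Fibonacci numbers `f₀ = f₁ = 1`, `f₂ = 2`, `f₃ = 3`, `f₄ = 5`, … -/
def fibo (i : ℕ) : ℕ := Nat.fib (i + 1)

/-- `F n`: the number of Fibonacci partitions of `n`, i.e. of finite sets of Fibonacci numbers
`f_i`, `i ≥ 1`, with sum `n`. -/
noncomputable def F (n : ℕ) : ℕ :=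
  {P : Finset ℕ | (∀ x ∈ P, ∃ i, 1 ≤ i ∧ x = fibo i) ∧ ∑ x ∈ P, x = n}.ncard

/-! ### 2-partitions, written as increasing lists -/

/-- A 2-partition `{i₁ < ⋯ < i_q}`: positive parts with consecutive gaps at least `2`. -/
def IsTwoPartition (I : List ℕ) : Prop :=
  (∀ i ∈ I, 1 ≤ i) ∧ I.IsChain (fun a b => a + 2 ≤ b)

/-- `f_I = f_{i₁} + ⋯ + f_{i_q}`. -/
def fsum (I : List ℕ) : ℕ := (I.map fibo).sum

/-- The Zeckendorf bijection from `ℕ` to 2-partitions. (Mathlib lists the indices in decreasing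
order, and with `f_i = Nat.fib (i + 1)`, hence the reversal and the shift by one.) -/
def Z (n : ℕ) : List ℕ := ((Nat.zeckendorf n).map (fun i => i - 1)).reverse

/-- `α(I)`: the first entry is `⌊(i₁ - 1)/2⌋ + 1` (take `prev = 1`), the later entries are
`⌊(i_r - i_{r-1})/2⌋ + 1`. -/
def assocAux (prev : ℕ) : List ℕ → List ℕ
  | [] => []
  | i :: I => ((i - prev) / 2 + 1) :: assocAux i I

/-- The associated vector of a 2-partition. -/
def assocVector (I : List ℕ) : List ℕ := assocAux 1 I

/-- The simple components of a 2-partition: its maximal runs of parts of equal parity. -/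
def components (I : List ℕ) : List (List ℕ) := I.splitBy (fun a b => decide (a % 2 = b % 2))

/-- The associated multivector `A₁ × ⋯ × A_s`: the associated vector, cut into consecutive blocks
of the sizes of the simple components. -/
def V (I : List ℕ) : List (List ℕ) :=
  ((components I).map List.length).splitLengths (assocVector I)

/-! ### The free monoid on the nonzero elements of `ℚ/ℤ` -/

/-- The group `ℚ/ℤ`. -/
abbrev QZ : Type := AddCircle (1 : ℚ)

/-- `Γ(ℚ/ℤ)`, the free monoid on the nonzero elements of `ℚ/ℤ`. -/
abbrev Gam : Type := FreeMonoid {g : QZ // g ≠ 0}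

/-- The representative in `[0, 1)` of a class in `ℚ/ℤ`. -/
noncomputable def rep (g : QZ) : ℚ := (AddCircle.equivIco (1 : ℚ) 0 g : ℚ)

/-- The homomorphism `δ`, with `δ(a₁/b₁ * ⋯ * a_s/b_s) = b₁ ⋯ b_s` (reduced fractions). -/
noncomputable def delta : Gam →* ℕ+ :=
  FreeMonoid.lift (fun g => ⟨(rep g.1).den, (rep g.1).den_pos⟩)

/-- `⟨α₁, …, α_q⟩ = 1/(α₁ - 1/(α₂ - ⋯ - 1/α_q))`. -/
def cf : List ℕ → ℚ
  | [] => 0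
  | a :: A => 1 / ((a : ℚ) - cf A)

open Classical in
/-- The class of `x` in `ℚ/ℤ` as an element of `Γ(ℚ/ℤ)`: a letter, or the unit if `x ∈ ℤ`. -/
noncomputable def letter (x : ℚ) : Gam :=
  if h : (x : QZ) = 0 then 1 else FreeMonoid.of ⟨(x : QZ), h⟩

/-- `p(A₁ × ⋯ × A_s) = (⟨A₁⟩ - ⌊⟨A₁⟩⌋) * ⟨A₂⟩ * ⋯ * ⟨A_s⟩`; a factor that is zero in `ℚ/ℤ`, which
occurs only for `A₁`, is the unit. -/
noncomputable def p (A : List (List ℕ)) : Gam := (A.map (fun B => letter (cf B))).prod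

/-- The map `π = p ∘ V ∘ Z`. -/
noncomputable def proj (n : ℕ) : Gam := p (V (Z n))

/-- The vector `c(a/b)` with `⟨c(a/b)⟩ = a/b`, computed by `α = ⌈b/a⌉` and
`a/b ↦ (a α - b)/a`, until the numerator is zero. -/
def cVec : ℕ → ℕ → List ℕ
  | 0, _ => []
  | a + 1, b => ((b + a) / (a + 1)) :: cVec ((a + 1) * ((b + a) / (a + 1)) - b) (a + 1)
termination_by a => a
decreasing_by
  have := Nat.mul_div_le (b + a) (a + 1)
  omega

/-- `c(g₁ * ⋯ * g_s) = c(g₁) × ⋯ × c(g_s)`. -/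
noncomputable def c (γ : Gam) : List (List ℕ) :=
  (FreeMonoid.toList γ).map (fun g => cVec (rep g.1).num.toNat (rep g.1).den)

/-- `n` has associated multivector `A`, and the lowest part of `Z n` (if any) is odd. -/
def IsTheta (A : List (List ℕ)) (n : ℕ) : Prop :=
  V (Z n) = A ∧ ∀ i ∈ (Z n).head?, Odd i

/-- `θ(γ) = f_I`, where `I` is the 2-partition with odd lowest part and multivector `c(γ)`. -/
noncomputable def theta (γ : Gam) : ℕ := sInf {n | IsTheta (c γ) n}

/-! ### The maps `ω`, `S`, `τ` on 2-partitions, and on `ℕ` -/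

/-- `ω` shifts all parts up by one if the lowest part is odd, down by one if it is even. -/
def omegaP : List ℕ → List ℕ
  | [] => []
  | i :: I => if i % 2 = 1 then (i :: I).map (· + 1) else (i :: I).map (· - 1)

/-- `S {i₁, …, i_q} = {2 - λ(i₁), i₁ + 2, …, i_q + 2}`, where `λ` is the residue modulo `2`;
the empty 2-partition is fixed. -/
def shiftP : List ℕ → List ℕ
  | [] => []
  | i :: I => (2 - i % 2) :: (i :: I).map (· + 2)

/-- `τ`. If `i₁ ≥ 3` then `τ {i₁, …, i_q} = {2 - λ(i₁), i₁ + 1, …, i_q + 1}`. If `i₁ ≤ 2` and `i₂`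
has the other parity then `τ {i₁, i₂, …, i_q} = {i₂ - 1, …, i_q - 1}`. If `i₁ ≤ 2` and `i₂` has the
same parity then `{i₁, i₂, …, i_q} = S J` with `J = {i₂ - 2, …, i_q - 2}`, and `τ (S J) = S (τ J)`.
The 2-partitions `∅`, `{1}`, `{2}`, and so all `S^r {1}`, `S^r {2}`, are fixed. -/
def tauP : List ℕ → List ℕ
  | [] => []
  | i :: I =>
    if 3 ≤ i then (2 - i % 2) :: (i :: I).map (· + 1)
    else match I with
      | [] => [i]
      | j :: J =>
        if i % 2 = j % 2 then shiftP (tauP ((j :: J).map (· - 2)))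
        else (j :: J).map (· - 1)
termination_by I => I.length

/-- `ω` on `ℕ`. -/
def omegaN (n : ℕ) : ℕ := fsum (omegaP (Z n))

/-- `τ` on `ℕ`. -/
def tauN (n : ℕ) : ℕ := fsum (tauP (Z n))

/-- `S` on `ℕ`. -/
def shiftN (n : ℕ) : ℕ := fsum (shiftP (Z n))

/-- The monoid `T` of maps `ℕ → ℕ` under composition that is generated by `ω`, `τ`, `S`. It acts on
`ℕ` by application: `t • n = t n`. -/
def T : Submonoid (Function.End ℕ) := Submonoid.closure {omegaN, tauN, shiftN}

/-- The orbit of `n`: its class under the equivalence relation generated by `n ∼ t n`, `t ∈ T`. -/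
def orbitClass (n : ℕ) : Set ℕ :=
  {m | Relation.EqvGen (fun a b => ∃ t : T, t • a = b) n m}

/-- `n` is regular if it is not of the form `f_r - 1`, `r ≥ 1`. -/
def Regular (n : ℕ) : Prop := ∀ r, 1 ≤ r → n + 1 ≠ fibo r

/-! ### Zeckendorf's theorem in the present notation -/

theorem isTwoPartition_Z (n : ℕ) : IsTwoPartition (Z n) := by
  have h := Nat.isZeckendorfRep_zeckendorf n
  unfold List.IsZeckendorfRep at h
  have h2 : ∀ i ∈ Nat.zeckendorf n, 2 ≤ i := by
    have htr : IsTrans ℕ (fun a b => b + 2 ≤ a) := ⟨fun _ _ _ _ _ => by omega⟩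
    rw [List.isChain_iff_pairwise, List.pairwise_append] at h
    intro i hi
    simpa using h.2.2 i hi 0 (by simp)
  refine ⟨?_, ?_⟩
  · intro i hi
    simp only [Z, List.mem_reverse, List.mem_map] at hi
    obtain ⟨a, ha, rfl⟩ := hi
    have := h2 a ha
    omega
  · have h' := h.left_of_append
    unfold Z
    rw [List.isChain_reverse, List.isChain_map]
    refine List.IsChain.imp_of_mem_imp ?_ h'
    intro a b ha hb hab
    have := h2 a ha
    have := h2 b hb
    omega

theorem fsum_Z (n : ℕ) : fsum (Z n) = n := by
  have h := Nat.isZeckendorfRep_zeckendorf n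
  have h2 : ∀ i ∈ Nat.zeckendorf n, 2 ≤ i := by
    have htr : IsTrans ℕ (fun a b => b + 2 ≤ a) := ⟨fun _ _ _ _ _ => by omega⟩
    unfold List.IsZeckendorfRep at h
    rw [List.isChain_iff_pairwise, List.pairwise_append] at h
    intro i hi
    simpa using h.2.2 i hi 0 (by simp)
  conv_rhs => rw [← Nat.sum_zeckendorf_fib n]
  unfold fsum Z
  rw [List.map_reverse, List.sum_reverse, List.map_map]
  congr 1
  apply List.map_congr_left
  intro i hi
  have := h2 i hi
  simp only [Function.comp, fibo]
  congr 1
  omega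

theorem Z_fsum {I : List ℕ} (hI : IsTwoPartition I) : Z (fsum I) = I := by
  have key : (I.reverse.map (· + 1)).IsZeckendorfRep := by
    unfold List.IsZeckendorfRep
    rw [List.isChain_append]
    refine ⟨?_, by simp, ?_⟩
    · rw [List.isChain_map, List.isChain_reverse]
      exact hI.2.imp (fun a b h => by omega)
    · intro x hx y hy
      have hx' := List.mem_of_mem_getLast? hx
      simp only [List.mem_map, List.mem_reverse] at hx'
      obtain ⟨a, ha, rfl⟩ := hx'
      have := hI.1 a ha
      simp at hy
      omega
  have hs : fsum I = ((I.reverse.map (· + 1)).map Nat.fib).sum := by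
    unfold fsum
    rw [List.map_map, List.map_reverse, List.sum_reverse]
    rfl
  unfold Z
  rw [hs, Nat.zeckendorf_sum_fib key, List.map_map, ← List.map_reverse, List.reverse_reverse]
  exact List.map_id I

end FibPart

open FibPart

namespace FibPart


/-! ### The multivector of a 2-partition, computed recursively -/

/-! Call a 2-partition primitive if its lowest part is odd and at least 3. On primitive 2-partitions
`V` is a bijection onto the nonempty multivectors with all entries at least 2: a gap is recovered
from its half, rounded down, and from whether the two parts agree in parity. Negative continued
fractions with entries at least 2 are unique, so `p` is a bijection from such multivectors, the
empty one included, to `Gam`, with inverse `c` (`p_injective`, `p_c`). Hence every non-unit `γ` has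
exactly one primitive preimage under `proj`, namely `theta γ`.

The three maps preserve `p ∘ V`: `ω` does not change `V`, `S` adds 1 to the first fraction, and `τ`
inserts or deletes a first block of value 1, a rule transported along powers of `S`. By
`twoPartition_induction` a 2-partition is either `∅`, `S^k {1}` or `S^k {2}`, which represent the
numbers `f_r - 1`, or it is reached from a primitive one by the monoid. So the regular numbers are
those outside the fibre over 1, and each regular orbit is the forward orbit of a single `theta γ`.
That element is least because the maps only increase the sum of a primitive 2-partition. The action
is free there: the parity of the lowest part detects `ω`, while the number of parts and the second
part separate `τ` from `S`.

For `F = δ ∘ π`, adjoin a new largest part with vector entry `α`. The count becomes `α` times the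
previous count, minus the count before that if the two largest parts have equal parity. This is the
recursion for denominators of continued fractions, restarted at each block (`F_fsum_append`).
Invariance of `F` then follows from that of `proj`. -/

theorem isTwoPartition_nil : IsTwoPartition [] := by simp [IsTwoPartition]

theorem isTwoPartition_singleton {i : ℕ} : IsTwoPartition [i] ↔ 1 ≤ i := by simp [IsTwoPartition]

theorem isTwoPartition_cons_cons {i j : ℕ} {I : List ℕ} :
    IsTwoPartition (i :: j :: I) ↔ 1 ≤ i ∧ i + 2 ≤ j ∧ IsTwoPartition (j :: I) := by
  simp only [IsTwoPartition, List.isChain_cons_cons, List.forall_mem_cons]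
  tauto

theorem IsTwoPartition.tail {i : ℕ} {I : List ℕ} (h : IsTwoPartition (i :: I)) :
    IsTwoPartition I :=
  ⟨fun j hj => h.1 j (List.mem_cons_of_mem _ hj), h.2.tail⟩

theorem IsTwoPartition.head_pos {i : ℕ} {I : List ℕ} (h : IsTwoPartition (i :: I)) : 1 ≤ i :=
  h.1 i List.mem_cons_self

/-- The entries contributed by the parts `I` that follow a part `i`: those in the same simple
component as `i`, and the blocks of the later components. -/
def tailBlocks : ℕ → List ℕ → List ℕ × List (List ℕ)
  | _, [] => ([], [])
  | i, j :: I =>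
    if i % 2 = j % 2 then (((j - i) / 2 + 1) :: (tailBlocks j I).1, (tailBlocks j I).2)
    else ([], (((j - i) / 2 + 1) :: (tailBlocks j I).1) :: (tailBlocks j I).2)

theorem assocAux_eq (i : ℕ) (I : List ℕ) :
    assocAux i I = (tailBlocks i I).1 ++ (tailBlocks i I).2.flatten := by
  induction I generalizing i with
  | nil => rfl
  | cons j I ih =>
    rw [assocAux, ih, tailBlocks]
    split_ifs <;> simp

/-- The accumulators have to be general for the induction: `g` holds the current run without its
last element `i`, and `gs` the finished runs in reverse order. -/
theorem map_length_splitBy_loop (i : ℕ) (I g : List ℕ) (gs : List (List ℕ)) :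
    (List.splitBy.loop (fun a b => decide (a % 2 = b % 2)) I i g gs).map List.length =
      gs.reverse.map List.length ++
        (g.length + 1 + (tailBlocks i I).1.length) :: (tailBlocks i I).2.map List.length := by
  induction I generalizing i g gs with
  | nil => simp [List.splitBy.loop, tailBlocks]
  | cons j I ih =>
    by_cases h : i % 2 = j % 2
    · simp only [List.splitBy.loop, h, decide_true, ih, tailBlocks, if_true, List.length_cons]
      congr 2
      omega
    · simp only [List.splitBy.loop, h, decide_false, ih, tailBlocks, if_false]
      simp
      omega

theorem splitLengths_map_length_flatten (L : List (List ℕ)) :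
    (L.map List.length).splitLengths L.flatten = L := by
  induction L with
  | nil => rfl
  | cons B L ih => simp [ih]

theorem V_nil : V [] = [] := rfl

/-- Replaces cutting by lengths with a recursion on the parts; all later statements about `V` of a
nonempty 2-partition rest on this form. -/
theorem V_cons (i : ℕ) (I : List ℕ) :
    V (i :: I) = (((i - 1) / 2 + 1) :: (tailBlocks i I).1) :: (tailBlocks i I).2 := by
  have h := map_length_splitBy_loop i I [] []
  simp only [List.reverse_nil, List.map_nil, List.nil_append, List.length_nil, zero_add] at h
  rw [V, components, List.splitBy, h, assocVector, assocAux, assocAux_eq]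
  rw [← splitLengths_map_length_flatten
    ((((i - 1) / 2 + 1) :: (tailBlocks i I).1) :: (tailBlocks i I).2)]
  congr 1
  simp [add_comm]

/-- Only differences and agreement of parities enter, so translation is invisible except in the
first entry of the first block. -/
theorem tailBlocks_map_add (k i : ℕ) (I : List ℕ) :
    tailBlocks (i + k) (I.map (· + k)) = tailBlocks i I := by
  induction I generalizing i with
  | nil => rfl
  | cons j I ih =>
    have h : (i + k) % 2 = (j + k) % 2 ↔ i % 2 = j % 2 := by omega
    simp only [List.map_cons, tailBlocks, ih, h, Nat.add_sub_add_right]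

/-- Multivectors with nonempty blocks and all entries at least `2`. -/
def IsReduced (A : List (List ℕ)) : Prop := ∀ B ∈ A, B ≠ [] ∧ ∀ a ∈ B, 2 ≤ a

theorem isReduced_nil : IsReduced [] := by simp [IsReduced]

theorem isReduced_cons {B : List ℕ} {A : List (List ℕ)} :
    IsReduced (B :: A) ↔ (B ≠ [] ∧ ∀ a ∈ B, 2 ≤ a) ∧ IsReduced A := by
  simp [IsReduced]

/-- Gaps of at least 2 give entries of at least 2. Thus the only entry of the vector that can equal
1 is the very first one, when the lowest part is 1 or 2. -/
theorem tailBlocks_reduced {i : ℕ} {I : List ℕ} (h : IsTwoPartition (i :: I)) :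
    (∀ a ∈ (tailBlocks i I).1, 2 ≤ a) ∧ IsReduced (tailBlocks i I).2 := by
  induction I generalizing i with
  | nil => simp [tailBlocks, isReduced_nil]
  | cons j I ih =>
    obtain ⟨_, h2, h3⟩ := isTwoPartition_cons_cons.1 h
    obtain ⟨h4, h5⟩ := ih h3
    have h6 : 2 ≤ (j - i) / 2 + 1 := by omega
    unfold tailBlocks
    split_ifs
    · simp only [List.forall_mem_cons]
      exact ⟨⟨h6, h4⟩, h5⟩
    · simp only [isReduced_cons, List.forall_mem_cons]
      exact ⟨by simp, ⟨by simp, h6, h4⟩, h5⟩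

/-- Whether a block continues or a new one starts tells the parity of the gap, and the entry tells
half the gap rounded down. -/
theorem tailBlocks_injective {i : ℕ} {I J : List ℕ} (hI : IsTwoPartition (i :: I))
    (hJ : IsTwoPartition (i :: J)) (h : tailBlocks i I = tailBlocks i J) : I = J := by
  induction I generalizing i J with
  | nil =>
    cases J with
    | nil => rfl
    | cons k J =>
      simp only [tailBlocks] at h
      split_ifs at h <;> simp at h
  | cons j I ih =>
    cases J with
    | nil =>
      simp only [tailBlocks] at h
      split_ifs at h <;> simp at h
    | cons k J =>
      rw [isTwoPartition_cons_cons] at hI hJ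
      have key : (j - i) / 2 = (k - i) / 2 ∧ (i % 2 = j % 2 ↔ i % 2 = k % 2) ∧
          tailBlocks j I = tailBlocks k J := by
        simp only [tailBlocks] at h
        rw [Prod.ext_iff (x := tailBlocks j I)]
        split_ifs at h <;> simp at h <;> tauto
      have hjk : j = k := by omega
      subst hjk
      rw [ih hI.2.2 hJ.2.2 key.2.2]

/-- An entry `b` is realized by the gap `2(b - 1)` inside a block and by `2(b - 1) + 1` at the start
of a new block. -/
theorem exists_tailBlocks_eq (A : List (List ℕ)) (hA : IsReduced A) (B : List ℕ)
    (hB : ∀ a ∈ B, 2 ≤ a) (i : ℕ) (hi : 1 ≤ i) :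
    ∃ I, IsTwoPartition (i :: I) ∧ tailBlocks i I = (B, A) := by
  induction A generalizing B i with
  | nil =>
    induction B generalizing i with
    | nil => exact ⟨[], isTwoPartition_singleton.2 hi, rfl⟩
    | cons b B ih =>
      have hb : 2 ≤ b := hB b List.mem_cons_self
      obtain ⟨I, h1, h2⟩ := ih (fun a ha => hB a (List.mem_cons_of_mem _ ha))
        (i + 2 * (b - 1)) (by omega)
      refine ⟨(i + 2 * (b - 1)) :: I, isTwoPartition_cons_cons.2 ⟨hi, by omega, h1⟩, ?_⟩
      rw [tailBlocks, if_pos (by omega), h2]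
      simp only [Prod.mk.injEq, List.cons.injEq, and_true]
      omega
  | cons C A ihA =>
    induction B generalizing i with
    | nil =>
      obtain ⟨⟨hC, hC'⟩, hA'⟩ := isReduced_cons.1 hA
      obtain ⟨b, C, rfl⟩ := List.exists_cons_of_ne_nil hC
      have hb : 2 ≤ b := hC' b List.mem_cons_self
      obtain ⟨I, h1, h2⟩ := ihA hA' C (fun a ha => hC' a (List.mem_cons_of_mem _ ha))
        (i + 2 * (b - 1) + 1) (by omega)
      refine ⟨(i + 2 * (b - 1) + 1) :: I, isTwoPartition_cons_cons.2 ⟨hi, by omega, h1⟩, ?_⟩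
      rw [tailBlocks, if_neg (by omega), h2]
      simp only [Prod.mk.injEq, List.cons.injEq, and_true, true_and]
      omega
    | cons b B ih =>
      have hb : 2 ≤ b := hB b List.mem_cons_self
      obtain ⟨I, h1, h2⟩ := ih (fun a ha => hB a (List.mem_cons_of_mem _ ha))
        (i + 2 * (b - 1)) (by omega)
      refine ⟨(i + 2 * (b - 1)) :: I, isTwoPartition_cons_cons.2 ⟨hi, by omega, h1⟩, ?_⟩
      rw [tailBlocks, if_pos (by omega), h2]
      simp only [Prod.mk.injEq, List.cons.injEq, and_true]
      omega

/-- The 2-partitions with odd lowest part at least `3`. -/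
def IsPrimitive (I : List ℕ) : Prop :=
  IsTwoPartition I ∧ ∃ i L, I = i :: L ∧ 3 ≤ i ∧ i % 2 = 1

theorem IsPrimitive.isReduced_V {I : List ℕ} (h : IsPrimitive I) : IsReduced (V I) := by
  obtain ⟨h1, i, L, rfl, hi, -⟩ := h
  rw [V_cons, isReduced_cons]
  obtain ⟨h4, h5⟩ := tailBlocks_reduced h1
  refine ⟨⟨by simp, ?_⟩, h5⟩
  rw [List.forall_mem_cons]
  exact ⟨by omega, h4⟩

theorem IsPrimitive.V_injective {I J : List ℕ} (hI : IsPrimitive I) (hJ : IsPrimitive J)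
    (h : V I = V J) : I = J := by
  obtain ⟨h1, i, L, rfl, hi, hi'⟩ := hI
  obtain ⟨h2, j, M, rfl, hj, hj'⟩ := hJ
  simp only [V_cons, List.cons.injEq] at h
  obtain ⟨⟨h3, h4⟩, h5⟩ := h
  have : i = j := by omega
  subst this
  rw [tailBlocks_injective h1 h2 (Prod.ext h4 h5)]

theorem exists_isPrimitive_V_eq {A : List (List ℕ)} (hA : IsReduced A) (hne : A ≠ []) :
    ∃ I, IsPrimitive I ∧ V I = A := by
  obtain ⟨B, A, rfl⟩ := List.exists_cons_of_ne_nil hne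
  obtain ⟨⟨hB, hB'⟩, hA'⟩ := isReduced_cons.1 hA
  obtain ⟨b, B, rfl⟩ := List.exists_cons_of_ne_nil hB
  have hb : 2 ≤ b := hB' b List.mem_cons_self
  -- `2b - 1` is the odd lowest part whose vector entry is `b`; it is at least 3 because `b ≥ 2`.
  obtain ⟨I, h1, h2⟩ := exists_tailBlocks_eq A hA' B
    (fun a ha => hB' a (List.mem_cons_of_mem _ ha)) (2 * b - 1) (by omega)
  refine ⟨(2 * b - 1) :: I, ⟨h1, _, _, rfl, by omega, by omega⟩, ?_⟩
  rw [V_cons, h2]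
  simp only [List.cons.injEq, and_true]
  omega

/-! ### Continued fractions -/

theorem cf_nonneg_lt_one {A : List ℕ} (h : ∀ a ∈ A, 2 ≤ a) : 0 ≤ cf A ∧ cf A < 1 := by
  induction A with
  | nil => simp [cf]
  | cons a A ih =>
    rw [List.forall_mem_cons] at h
    obtain ⟨h1, h2⟩ := ih h.2
    have ha : (2 : ℚ) ≤ a := by exact_mod_cast h.1
    rw [cf]
    refine ⟨by apply div_nonneg <;> linarith, ?_⟩
    rw [div_lt_one] <;> linarith

theorem cf_cons_pos {a : ℕ} {A : List ℕ} (ha : 1 ≤ a) (h : ∀ b ∈ A, 2 ≤ b) :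
    0 < cf (a :: A) := by
  have h1 := (cf_nonneg_lt_one h).2
  have ha : (1 : ℚ) ≤ a := by exact_mod_cast ha
  rw [cf]
  apply one_div_pos.2
  linarith

theorem cf_pos {A : List ℕ} (hne : A ≠ []) (h : ∀ a ∈ A, 2 ≤ a) : 0 < cf A := by
  obtain ⟨a, A, rfl⟩ := List.exists_cons_of_ne_nil hne
  rw [List.forall_mem_cons] at h
  exact cf_cons_pos (by omega) h.2

/-- The reciprocal of `cf (a :: A)` is `a - cf A`, with `cf A` in `[0, 1)`; so `a` is its ceiling,
and the rest follows inductively. -/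
theorem cf_injective {A B : List ℕ} (hA : ∀ a ∈ A, 2 ≤ a) (hB : ∀ a ∈ B, 2 ≤ a)
    (h : cf A = cf B) : A = B := by
  induction A generalizing B with
  | nil =>
    by_contra hne
    have := cf_pos (Ne.symm hne) hB
    rw [← h] at this
    exact lt_irrefl _ this
  | cons a A ih =>
    cases B with
    | nil =>
      have := cf_pos (by simp) hA
      rw [h] at this
      exact absurd this (lt_irrefl _)
    | cons b B =>
      rw [List.forall_mem_cons] at hA hB
      obtain ⟨h1, h2⟩ := cf_nonneg_lt_one hA.2
      obtain ⟨h3, h4⟩ := cf_nonneg_lt_one hB.2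
      simp only [cf, one_div, inv_inj] at h
      have hab : (a : ℤ) = b := by
        have h5 : (a : ℚ) < b + 1 := by linarith
        have h6 : (b : ℚ) < a + 1 := by linarith
        have h5' : a < b + 1 := by exact_mod_cast h5
        have h6' : b < a + 1 := by exact_mod_cast h6
        omega
      have hab' : a = b := by exact_mod_cast hab
      subst hab'
      rw [ih hA.2 hB.2 (by linarith)]

theorem cVec_spec (a b : ℕ) (hab : a < b) :
    cf (cVec a b) = a / b ∧ (∀ x ∈ cVec a b, 2 ≤ x) ∧ (0 < a → cVec a b ≠ []) := by
  induction a using Nat.strong_induction_on generalizing b with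
  | _ a ih =>
    cases a with
    | zero => simp [cVec, cf]
    | succ a =>
      have h1 := Nat.mul_div_le (b + a) (a + 1)
      have h2 := Nat.lt_mul_div_succ (b + a) (Nat.succ_pos a)
      -- The numerator is `a + 1`, so `m` is the ceiling of `b / (a + 1)`. The next numerator `(a +
      -- 1) m - b` is therefore nonnegative and below `a + 1`.
      set m := (b + a) / (a + 1) with hm
      have hm2 : 2 ≤ m := by
        rw [hm, Nat.le_div_iff_mul_le (Nat.succ_pos a)]
        omega
      have h3 : b ≤ (a + 1) * m := by
        simp only [Nat.succ_eq_add_one, mul_add, mul_one] at h2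
        omega
      have h4 : (a + 1) * m - b < a + 1 := by omega
      obtain ⟨i1, i2, -⟩ := ih _ h4 (a + 1) h4
      rw [cVec, ← hm]
      refine ⟨?_, ?_, by simp⟩
      · rw [cf, i1, Nat.cast_sub h3]
        push_cast
        have hb : (b : ℚ) ≠ 0 := by
          have : b ≠ 0 := by omega
          exact_mod_cast this
        have ha : (a : ℚ) + 1 ≠ 0 := by positivity
        have : (m : ℚ) - ((a + 1) * m - b) / (a + 1) = b / (a + 1) := by
          field_simp
          ring
        rw [this, one_div_div]
      · rw [List.forall_mem_cons]
        exact ⟨hm2, i2⟩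

/-! ### Letters of the free monoid -/

theorem rep_mem (g : QZ) : 0 ≤ rep g ∧ rep g < 1 := by
  have := (AddCircle.equivIco (1 : ℚ) 0 g).2
  simpa [rep] using this

theorem coe_rep (g : QZ) : ((rep g : ℚ) : QZ) = g := AddCircle.coe_equivIco

theorem rep_coe {x : ℚ} (h0 : 0 ≤ x) (h1 : x < 1) : rep (x : QZ) = x := by
  unfold rep
  rw [AddCircle.equivIco_coe_eq (p := (1 : ℚ)) (a := 0) (x := x) (by simpa using ⟨h0, h1⟩)]

theorem rep_zero : rep 0 = 0 := by
  simpa using rep_coe (x := 0) le_rfl one_pos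

theorem coe_ne_zero {x : ℚ} (h0 : 0 < x) (h1 : x < 1) : (x : QZ) ≠ 0 := by
  intro h
  have := rep_coe h0.le h1
  rw [h, rep_zero] at this
  exact h0.ne this

theorem letter_of_mem {x : ℚ} (h0 : 0 < x) (h1 : x < 1) :
    letter x = FreeMonoid.of ⟨(x : QZ), coe_ne_zero h0 h1⟩ := dif_neg (coe_ne_zero h0 h1)

theorem letter_add_one (x : ℚ) : letter (x + 1) = letter x := by
  have h : ((x + 1 : ℚ) : QZ) = (x : QZ) := by
    have h1 := AddCircle.coe_period (1 : ℚ)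
    rw [QuotientAddGroup.mk_add, h1, add_zero]
  unfold letter
  simp only [h]

theorem letter_zero : letter 0 = 1 := by
  unfold letter
  rw [dif_pos]
  simp

theorem letter_one : letter 1 = 1 := by
  have h := letter_add_one 0
  rwa [zero_add, letter_zero] at h

theorem letter_rep (g : {g : QZ // g ≠ 0}) : letter (rep g.1) = FreeMonoid.of g := by
  unfold letter
  rw [dif_neg]
  · congr 1
    exact Subtype.ext (coe_rep _)
  · rw [coe_rep]
    exact g.2

theorem letter_fract (x : ℚ) : letter (Int.fract x) = letter x := by
  have h : ((Int.fract x : ℚ) : QZ) = (x : QZ) := by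
    rw [QuotientAddGroup.eq_iff_sub_mem, AddSubgroup.mem_zmultiples_iff]
    exact ⟨-⌊x⌋, by rw [← Int.self_sub_floor]; simp⟩
  unfold letter
  simp only [h]

theorem delta_of (g : {g : QZ // g ≠ 0}) : (delta (FreeMonoid.of g) : ℕ) = (rep g.1).den :=
  congrArg PNat.val (FreeMonoid.lift_eval_of _ g)

/-- Integer translation preserves denominators, so the formula needs no bounds on `x`; integers give
the unit and denominator 1. -/
theorem delta_letter (x : ℚ) : (delta (letter x) : ℕ) = x.den := by
  have hden : (Int.fract x).den = x.den := by
    have := Rat.add_intCast_den x (-⌊x⌋)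
    rw [← this, Int.fract, sub_eq_add_neg]
    push_cast
    rfl
  rw [← letter_fract, ← hden]
  rcases (Int.fract_nonneg x).eq_or_lt with h | h
  · rw [← h, letter_zero, map_one]
    rfl
  · rw [letter_of_mem h (Int.fract_lt_one x), delta_of, rep_coe h.le (Int.fract_lt_one x)]

/-! ### The map `p` on reduced multivectors -/

theorem p_nil : p [] = 1 := rfl

theorem p_cons (B : List ℕ) (A : List (List ℕ)) : p (B :: A) = letter (cf B) * p A := by
  simp [p]

theorem letter_cf_eq {B : List ℕ} (hB : B ≠ [] ∧ ∀ a ∈ B, 2 ≤ a) :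
    letter (cf B) = FreeMonoid.of ⟨(cf B : QZ),
      coe_ne_zero (cf_pos hB.1 hB.2) (cf_nonneg_lt_one hB.2).2⟩ :=
  letter_of_mem (cf_pos hB.1 hB.2) (cf_nonneg_lt_one hB.2).2

theorem p_ne_one {A : List (List ℕ)} (hA : IsReduced A) (hne : A ≠ []) : p A ≠ 1 := by
  obtain ⟨B, A, rfl⟩ := List.exists_cons_of_ne_nil hne
  intro h
  rw [p_cons, letter_cf_eq (isReduced_cons.1 hA).1] at h
  have := congrArg FreeMonoid.length h
  simp [FreeMonoid.length_mul] at this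

/-- Each block of a reduced multivector contributes exactly one letter, so equality in the free
monoid can be compared letter by letter, and `rep` recovers the fraction. -/
theorem p_injective {A B : List (List ℕ)} (hA : IsReduced A) (hB : IsReduced B)
    (h : p A = p B) : A = B := by
  induction A generalizing B with
  | nil =>
    by_contra hne
    exact p_ne_one hB (Ne.symm hne) h.symm
  | cons C A ih =>
    cases B with
    | nil => exact absurd h (p_ne_one hA (by simp))
    | cons D B =>
      rw [isReduced_cons] at hA hB
      rw [p_cons, p_cons, letter_cf_eq hA.1, letter_cf_eq hB.1] at h
      have h' := congrArg FreeMonoid.toList h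
      simp only [FreeMonoid.toList_of_mul, List.cons.injEq, Subtype.mk.injEq] at h'
      have hcf := congrArg rep h'.1
      obtain ⟨c1, c2⟩ := cf_nonneg_lt_one hA.1.2
      obtain ⟨d1, d2⟩ := cf_nonneg_lt_one hB.1.2
      rw [rep_coe c1 c2, rep_coe d1 d2] at hcf
      rw [cf_injective hA.1.2 hB.1.2 hcf, ih hA.2 hB.2 (FreeMonoid.toList.injective h'.2)]

theorem rep_pos (g : {g : QZ // g ≠ 0}) : 0 < rep g.1 := by
  refine lt_of_le_of_ne (rep_mem g.1).1 fun h => g.2 ?_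
  rw [← coe_rep g.1, ← h]
  simp

theorem cVec_rep_spec (g : {g : QZ // g ≠ 0}) :
    cf (cVec (rep g.1).num.toNat (rep g.1).den) = rep g.1 ∧
      cVec (rep g.1).num.toNat (rep g.1).den ≠ [] ∧
      ∀ x ∈ cVec (rep g.1).num.toNat (rep g.1).den, 2 ≤ x := by
  have h0 := rep_pos g
  have h1 := (rep_mem g.1).2
  set x := rep g.1
  have hn : 0 < x.num := Rat.num_pos.2 h0
  have hlt : x.num.toNat < x.den := by
    have := Rat.num_lt_denom_iff.2 h1
    omega
  obtain ⟨a, b, c⟩ := cVec_spec _ _ hlt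
  refine ⟨?_, c (by omega), b⟩
  rw [a]
  have h2 : ((x.num.toNat : ℕ) : ℚ) = (x.num : ℚ) := by
    have : ((x.num.toNat : ℕ) : ℤ) = x.num := Int.toNat_of_nonneg hn.le
    exact_mod_cast this
  rw [h2, Rat.num_div_den]

theorem isReduced_c (γ : Gam) : IsReduced (c γ) := by
  intro B hB
  simp only [c, List.mem_map] at hB
  obtain ⟨g, -, rfl⟩ := hB
  exact (cVec_rep_spec g).2

theorem p_c (γ : Gam) : p (c γ) = γ := by
  induction γ using FreeMonoid.inductionOn' with
  | one => rfl
  | of_mul g γ ih =>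
    have : c (FreeMonoid.of g * γ) =
        cVec (rep g.1).num.toNat (rep g.1).den :: c γ := by
      simp [c]
    rw [this, p_cons, ih, (cVec_rep_spec g).1, letter_rep]

theorem c_ne_nil {γ : Gam} (h : γ ≠ 1) : c γ ≠ [] := by
  intro h'
  apply h
  rw [← p_c γ, h', p_nil]


/-! ### The maps `ω`, `S`, `τ` on 2-partitions -/

theorem isTwoPartition_map_add {I : List ℕ} (k : ℕ) (h : IsTwoPartition I) :
    IsTwoPartition (I.map (· + k)) := by
  refine ⟨?_, ?_⟩
  · intro i hi
    obtain ⟨a, ha, rfl⟩ := List.mem_map.1 hi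
    have := h.1 a ha
    omega
  · rw [List.isChain_map]
    exact h.2.imp fun a b hab => by omega

theorem IsTwoPartition.head_le {i : ℕ} {I : List ℕ} (h : IsTwoPartition (i :: I)) :
    ∀ a ∈ i :: I, i ≤ a := by
  have := h.2.imp (fun a b (hab : a + 2 ≤ b) => (show a ≤ b by omega))
  rw [List.isChain_iff_pairwise] at this
  simpa using fun a ha => List.rel_of_pairwise_cons this ha

/-- A 2-partition whose lowest part exceeds `k` is a translate by `k`. -/
theorem IsTwoPartition.exists_eq_map_add {i : ℕ} {I : List ℕ} (h : IsTwoPartition (i :: I))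
    (k : ℕ) (hk : k < i) : ∃ j J, IsTwoPartition (j :: J) ∧ i = j + k ∧ I = J.map (· + k) := by
  have hle := h.head_le
  refine ⟨i - k, I.map (· - k), ?_, by omega, ?_⟩
  · have h1 : IsTwoPartition ((i :: I).map (· - k)) := by
      refine ⟨?_, ?_⟩
      · intro a ha
        obtain ⟨b, hb, rfl⟩ := List.mem_map.1 ha
        have := hle b hb
        omega
      · rw [List.isChain_map]
        refine h.2.imp_of_mem_imp ?_
        intro a b ha hb hab
        have := hle a ha
        omega
    exact h1
  · rw [List.map_map]
    conv_lhs => rw [← List.map_id I]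
    apply List.map_congr_left
    intro a ha
    have := hle a (List.mem_cons_of_mem _ ha)
    simp only [Function.comp, id]
    omega

theorem map_add_map_sub (k : ℕ) (I : List ℕ) : (I.map (· + k)).map (· - k) = I := by
  rw [List.map_map]
  conv_rhs => rw [← List.map_id I]
  apply List.map_congr_left
  intro a _
  simp

theorem isTwoPartition_shiftP {I : List ℕ} (h : IsTwoPartition I) : IsTwoPartition (shiftP I) := by
  cases I with
  | nil => exact isTwoPartition_nil
  | cons i I =>
    have h1 := h.head_pos
    have h2 := isTwoPartition_map_add 2 h
    rw [shiftP, List.map_cons, isTwoPartition_cons_cons]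
    exact ⟨by omega, by omega, h2⟩

theorem isTwoPartition_omegaP {I : List ℕ} (h : IsTwoPartition I) : IsTwoPartition (omegaP I) := by
  cases I with
  | nil => exact isTwoPartition_nil
  | cons i I =>
    have h1 := h.head_pos
    rw [omegaP]
    split_ifs with hi
    · exact isTwoPartition_map_add 1 h
    · obtain ⟨j, J, hJ, rfl, rfl⟩ := h.exists_eq_map_add 1 (by omega)
      rw [← List.map_cons (f := (· + 1)), map_add_map_sub]
      exact hJ

theorem omegaP_odd {i : ℕ} (I : List ℕ) (hi : i % 2 = 1) :
    omegaP (i :: I) = (i + 1) :: I.map (· + 1) := by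
  simp [omegaP, hi]

/-- Writing the even case as a translate avoids truncated subtraction. -/
theorem omegaP_even {j : ℕ} (J : List ℕ) (hj : j % 2 = 1) :
    omegaP ((j + 1) :: J.map (· + 1)) = j :: J := by
  have h := map_add_map_sub 1 (j :: J)
  rw [List.map_cons] at h
  rw [omegaP, if_neg (by omega), h]

/-- A nonempty 2-partition either has odd lowest part or is the image of one under `ω`. -/
theorem IsTwoPartition.odd_or_omegaP {i : ℕ} {I : List ℕ} (h : IsTwoPartition (i :: I)) :
    i % 2 = 1 ∨ ∃ j J, IsTwoPartition (j :: J) ∧ j % 2 = 1 ∧ i = j + 1 ∧ I = J.map (· + 1) := by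
  have h1 := h.head_pos
  by_cases hi : i % 2 = 1
  · exact Or.inl hi
  · obtain ⟨j, J, hJ, rfl, rfl⟩ := h.exists_eq_map_add 1 (by omega)
    exact Or.inr ⟨j, J, hJ, by omega, rfl, rfl⟩

theorem omegaP_omegaP {I : List ℕ} (h : IsTwoPartition I) : omegaP (omegaP I) = I := by
  cases I with
  | nil => rfl
  | cons i I =>
    rcases h.odd_or_omegaP with hi | ⟨j, J, hJ, hj, rfl, rfl⟩
    · rw [omegaP_odd _ hi, omegaP_even _ hi]
    · rw [omegaP_even _ hj, omegaP_odd _ hj]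

theorem shiftP_cons (i : ℕ) (I : List ℕ) :
    shiftP (i :: I) = (2 - i % 2) :: (i + 2) :: I.map (· + 2) := rfl

theorem omegaP_shiftP {I : List ℕ} (h : IsTwoPartition I) :
    omegaP (shiftP I) = shiftP (omegaP I) := by
  cases I with
  | nil => rfl
  | cons i I =>
    rcases h.odd_or_omegaP with hi | ⟨j, J, hJ, hj, rfl, rfl⟩
    · have h2 : (i + 1) % 2 = 0 := by omega
      rw [omegaP_odd _ hi, shiftP_cons, shiftP_cons, hi, h2, omegaP_odd _ (by norm_num)]
      simp [Function.comp_def, add_assoc]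
    · have h2 : (j + 1) % 2 = 0 := by omega
      rw [omegaP_even _ hj, shiftP_cons, shiftP_cons, hj, h2]
      have := omegaP_even (j := 1) ((j + 2) :: J.map (· + 2)) (by norm_num)
      rw [← this]
      simp [Function.comp_def, add_assoc]

theorem tauP_nil : tauP [] = [] := by rw [tauP]

theorem tauP_one : tauP [1] = [1] := by simp [tauP]

theorem tauP_two : tauP [2] = [2] := by simp [tauP]

theorem tauP_of_three_le {i : ℕ} (I : List ℕ) (hi : 3 ≤ i) :
    tauP (i :: I) = (2 - i % 2) :: (i + 1) :: I.map (· + 1) := by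
  cases I <;> rw [tauP, if_pos hi, List.map_cons]

/-- The inserted part has the parity of `i`, hence not that of its successor `i + 1`; the second
application takes the branch that deletes it. -/
theorem tauP_tauP_of_three_le {i : ℕ} (I : List ℕ) (hi : 3 ≤ i) :
    tauP (tauP (i :: I)) = i :: I := by
  have h := map_add_map_sub 1 (i :: I)
  rw [List.map_cons] at h
  rw [tauP_of_three_le I hi, tauP, if_neg (by omega)]
  rw [if_neg (by omega), h]

/-- The two lowest parts of `shiftP (i :: I)` have equal parity, which is exactly the recursive
branch of `tauP`. -/
theorem tauP_shiftP (I : List ℕ) : tauP (shiftP I) = shiftP (tauP I) := by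
  cases I with
  | nil => rw [shiftP, tauP_nil, shiftP]
  | cons i I =>
    have h := map_add_map_sub 2 (i :: I)
    rw [List.map_cons] at h
    rw [shiftP_cons, tauP, if_neg (by omega)]
    rw [if_pos (by omega), h]

theorem isTwoPartition_tauP_of_three_le {i : ℕ} {I : List ℕ} (hi : 3 ≤ i)
    (h : IsTwoPartition (i :: I)) : IsTwoPartition (tauP (i :: I)) := by
  rw [tauP_of_three_le I hi, isTwoPartition_cons_cons]
  exact ⟨by omega, by omega, isTwoPartition_map_add 1 h⟩

/-- Induction along the decomposition `S^r τ^b I'` of 2-partitions. -/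
theorem twoPartition_induction {motive : ∀ I, IsTwoPartition I → Prop}
    (nil : motive [] isTwoPartition_nil)
    (one : motive [1] (isTwoPartition_singleton.2 le_rfl))
    (two : motive [2] (isTwoPartition_singleton.2 one_le_two))
    (large : ∀ i I, 3 ≤ i → ∀ h : IsTwoPartition (i :: I), motive (i :: I) h)
    (tau : ∀ i I (hi : 3 ≤ i) (h : IsTwoPartition (i :: I)),
      motive (tauP (i :: I)) (isTwoPartition_tauP_of_three_le hi h))
    (shift : ∀ i I (h : IsTwoPartition (i :: I)), motive (i :: I) h →
      motive (shiftP (i :: I)) (isTwoPartition_shiftP h))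
    (I : List ℕ) (hI : IsTwoPartition I) : motive I hI := by
  induction hn : I.length using Nat.strong_induction_on generalizing I with
  | _ n ih =>
    cases I with
    | nil => exact nil
    | cons i I =>
      have h1 := hI.head_pos
      by_cases hi : 3 ≤ i
      · exact large i I hi hI
      cases I with
      | nil =>
        have : i = 1 ∨ i = 2 := by omega
        rcases this with rfl | rfl
        · exact one
        · exact two
      | cons j J =>
        obtain ⟨_, h2, h3⟩ := isTwoPartition_cons_cons.1 hI
        by_cases hp : i % 2 = j % 2
        · obtain ⟨k, K, hK, rfl, rfl⟩ := h3.exists_eq_map_add 2 (by omega)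
          have h4 := shift k K hK (ih (K.length + 1)
            (by simp only [List.length_cons, List.length_map] at hn; omega) _ hK rfl)
          have h5 : 2 - k % 2 = i := by omega
          simpa only [shiftP_cons, h5] using h4
        · obtain ⟨k, K, hK, rfl, rfl⟩ := h3.exists_eq_map_add 1 (by omega)
          have h4 := tau k K (by omega) hK
          have h5 : 2 - k % 2 = i := by omega
          simpa only [tauP_of_three_le _ (show 3 ≤ k by omega), h5] using h4

theorem isTwoPartition_tauP {I : List ℕ} (h : IsTwoPartition I) : IsTwoPartition (tauP I) := by
  induction I, h using twoPartition_induction with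
  | nil => rw [tauP_nil]; exact isTwoPartition_nil
  | one => rw [tauP_one]; exact isTwoPartition_singleton.2 le_rfl
  | two => rw [tauP_two]; exact isTwoPartition_singleton.2 one_le_two
  | large i I hi h => exact isTwoPartition_tauP_of_three_le hi h
  | tau i I hi h => rwa [tauP_tauP_of_three_le I hi]
  | shift i I h ih => rw [tauP_shiftP]; exact isTwoPartition_shiftP ih

theorem tauP_tauP {I : List ℕ} (h : IsTwoPartition I) : tauP (tauP I) = I := by
  induction I, h using twoPartition_induction with
  | nil => rw [tauP_nil, tauP_nil]
  | one => rw [tauP_one, tauP_one]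
  | two => rw [tauP_two, tauP_two]
  | large i I hi h => exact tauP_tauP_of_three_le I hi
  | tau i I hi h => rw [tauP_tauP_of_three_le I hi]
  | shift i I h ih => rw [tauP_shiftP, tauP_shiftP, ih]

theorem omegaP_tauP_of_three_le {i : ℕ} {I : List ℕ} (hi : 3 ≤ i)
    (h : IsTwoPartition (i :: I)) : omegaP (tauP (i :: I)) = tauP (omegaP (i :: I)) := by
  rcases h.odd_or_omegaP with hi' | ⟨j, J, hJ, hj, rfl, rfl⟩
  · have h2 : (i + 1) % 2 = 0 := by omega
    rw [omegaP_odd _ hi', tauP_of_three_le _ hi, tauP_of_three_le _ (by omega), hi', h2,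
      omegaP_odd _ (by norm_num)]
    simp
  · have h2 : (j + 1) % 2 = 0 := by omega
    rw [omegaP_even _ hj, tauP_of_three_le _ hi, tauP_of_three_le _ (by omega), hj, h2]
    have := omegaP_even (j := 1) ((j + 1) :: J.map (· + 1)) (by norm_num)
    rw [← this]
    simp

theorem omegaP_tauP {I : List ℕ} (h : IsTwoPartition I) : omegaP (tauP I) = tauP (omegaP I) := by
  induction I, h using twoPartition_induction with
  | nil => simp [omegaP, tauP_nil]
  | one => simp [omegaP, tauP_one, tauP_two]
  | two => simp [omegaP, tauP_one, tauP_two]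
  | large i I hi h => exact omegaP_tauP_of_three_le hi h
  | tau i I hi h =>
    rw [tauP_tauP_of_three_le I hi, omegaP_tauP_of_three_le hi h,
      tauP_tauP (isTwoPartition_omegaP h)]
  | shift i I h ih =>
    rw [tauP_shiftP, omegaP_shiftP (isTwoPartition_tauP h), ih, omegaP_shiftP h, tauP_shiftP]

/-! ### Lengths and parities -/

theorem length_shiftP {I : List ℕ} (h : I ≠ []) : (shiftP I).length = I.length + 1 := by
  cases I with
  | nil => exact absurd rfl h
  | cons i I => simp [shiftP]

theorem shiftP_injective {I J : List ℕ} (hI : I ≠ []) (hJ : J ≠ []) (h : shiftP I = shiftP J) :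
    I = J := by
  obtain ⟨i, I, rfl⟩ := List.exists_cons_of_ne_nil hI
  obtain ⟨j, J, rfl⟩ := List.exists_cons_of_ne_nil hJ
  rw [shiftP, shiftP, List.cons.injEq] at h
  rw [← map_add_map_sub 2 (i :: I), h.2, map_add_map_sub]

theorem shiftP_ne_nil {I : List ℕ} (h : I ≠ []) : shiftP I ≠ [] := by
  obtain ⟨i, I, rfl⟩ := List.exists_cons_of_ne_nil h
  simp [shiftP]

/-- The parity of the lowest part, `0` for the empty partition. -/
def headParity (I : List ℕ) : ℕ := I.headD 0 % 2

theorem headParity_shiftP {I : List ℕ} : headParity (shiftP I) = headParity I := by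
  cases I with
  | nil => rfl
  | cons i I =>
    simp only [shiftP_cons, headParity, List.headD_cons]
    omega

theorem headParity_tauP_of_three_le {i : ℕ} (I : List ℕ) (hi : 3 ≤ i) :
    headParity (tauP (i :: I)) = headParity (i :: I) := by
  simp only [tauP_of_three_le I hi, headParity, List.headD_cons]
  omega

/-! ### Invariance of `p ∘ V` -/

/-- The multivector itself is unchanged: `⌊(i - 1)/2⌋` is the same for an odd `i` and for `i + 1`.
-/
theorem V_omegaP {I : List ℕ} (h : IsTwoPartition I) : V (omegaP I) = V I := by
  cases I with
  | nil => rfl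
  | cons i I =>
    have key : ∀ (i : ℕ) (I : List ℕ), i % 2 = 1 → V ((i + 1) :: I.map (· + 1)) = V (i :: I) := by
      intro i I hi
      have : (i + 1 - 1) / 2 = (i - 1) / 2 := by omega
      rw [V_cons, V_cons, tailBlocks_map_add, this]
    rcases h.odd_or_omegaP with hi | ⟨j, J, hJ, hj, rfl, rfl⟩
    · rw [omegaP_odd _ hi, key _ _ hi]
    · rw [omegaP_even _ hj, key _ _ hj]

/-- With `1/x` the first fraction, `S` replaces `x` by `1, x + 1`, and `1/(1 - 1/(x + 1)) = 1/x + 1`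
is the same class modulo the integers. -/
theorem p_V_shiftP {I : List ℕ} (h : IsTwoPartition I) : p (V (shiftP I)) = p (V I) := by
  cases I with
  | nil => rfl
  | cons i I =>
    have h1 := h.head_pos
    obtain ⟨h2, -⟩ := tailBlocks_reduced h
    obtain ⟨h3, h4⟩ := cf_nonneg_lt_one h2
    have e1 : (2 - i % 2 - 1) / 2 = 0 := by omega
    have e2 : (i + 2 - (2 - i % 2)) / 2 = (i - 1) / 2 + 1 := by omega
    rw [shiftP_cons, V_cons, V_cons, tailBlocks, if_pos (by omega), tailBlocks_map_add, e1, e2,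
      p_cons, p_cons]
    congr 1
    rw [← letter_add_one (cf (((i - 1) / 2 + 1) :: _)), cf, cf, cf]
    congr 1
    push_cast
    have h5 : (0 : ℚ) ≤ (((i - 1) / 2 : ℕ) : ℚ) := Nat.cast_nonneg _
    set m : ℚ := (((i - 1) / 2 : ℕ) : ℚ)
    set y := cf (tailBlocks i I).1
    have h6 : m + 1 - y ≠ 0 := by linarith
    have h7 : m + 1 + 1 - y ≠ 0 := by linarith
    have h8 : 1 - 1 / (m + 1 + 1 - y) = (m + 1 - y) / (m + 1 + 1 - y) := by
      field_simp
      ring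
    rw [h8, one_div_div]
    field_simp
    ring

/-- The inserted part forms a block `(1)` of its own, of integral value, and the entry of the old
lowest part is unchanged. -/
theorem p_V_tauP_of_three_le {i : ℕ} (I : List ℕ) (hi : 3 ≤ i) :
    p (V (tauP (i :: I))) = p (V (i :: I)) := by
  have e1 : (2 - i % 2 - 1) / 2 = 0 := by omega
  have e2 : (i + 1 - (2 - i % 2)) / 2 = (i - 1) / 2 := by omega
  rw [tauP_of_three_le I hi, V_cons, V_cons, tailBlocks, if_neg (by omega), tailBlocks_map_add,
    e1, e2, p_cons]
  have : cf [0 + 1] = 1 := by simp [cf]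
  rw [this, letter_one, one_mul]

theorem p_V_tauP {I : List ℕ} (h : IsTwoPartition I) : p (V (tauP I)) = p (V I) := by
  induction I, h using twoPartition_induction with
  | nil => rw [tauP_nil]
  | one => rw [tauP_one]
  | two => rw [tauP_two]
  | large i I hi h => exact p_V_tauP_of_three_le I hi
  | tau i I hi h => rw [tauP_tauP_of_three_le I hi, p_V_tauP_of_three_le I hi]
  | shift i I h ih =>
    rw [tauP_shiftP, p_V_shiftP (isTwoPartition_tauP h), p_V_shiftP h, ih]


/-! ### Fibonacci numbers -/

theorem fibo_add_two (i : ℕ) : fibo (i + 2) = fibo (i + 1) + fibo i := by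
  simp only [fibo]
  rw [Nat.fib_add_two (n := i + 1), add_comm]

theorem fibo_one : fibo 1 = 1 := rfl

theorem fibo_pos (i : ℕ) : 0 < fibo i := Nat.fib_pos.2 (Nat.succ_pos i)

theorem fibo_mono : Monotone fibo := fun _ _ h => Nat.fib_mono (Nat.succ_le_succ h)

theorem fibo_lt_succ {i : ℕ} (hi : 1 ≤ i) : fibo i < fibo (i + 1) :=
  Nat.fib_lt_fib_succ (by omega)

theorem fibo_injOn {i j : ℕ} (hi : 1 ≤ i) (hj : 1 ≤ j) (h : fibo i = fibo j) : i = j := by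
  rcases lt_trichotomy i j with hij | hij | hij
  · have := fibo_lt_succ hi
    have := fibo_mono (show i + 1 ≤ j from hij)
    omega
  · exact hij
  · have := fibo_lt_succ hj
    have := fibo_mono (show j + 1 ≤ i from hij)
    omega

theorem fsum_nil : fsum [] = 0 := rfl

theorem fsum_cons (i : ℕ) (I : List ℕ) : fsum (i :: I) = fibo i + fsum I := by simp [fsum]

theorem fsum_append (I J : List ℕ) : fsum (I ++ J) = fsum I + fsum J := by simp [fsum]

/-! ### Fibonacci partitions with bounded parts -/

/-- The number of sets of indices in `{1, …, k}` whose Fibonacci numbers have sum `n`. -/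
def boundedCount : ℕ → ℕ → ℕ
  | 0, n => if n = 0 then 1 else 0
  | k + 1, n =>
    boundedCount k n + if fibo (k + 1) ≤ n then boundedCount k (n - fibo (k + 1)) else 0

theorem boundedCount_eq_card (k n : ℕ) :
    boundedCount k n =
      ((Finset.Icc 1 k).powerset.filter (fun Q => ∑ i ∈ Q, fibo i = n)).card := by
  induction k generalizing n with
  | zero =>
    rcases Nat.eq_zero_or_pos n with rfl | h
    · rfl
    · have h1 : n ≠ 0 := by omega
      simp [boundedCount, h1, Finset.filter_singleton, h1.symm]
  | succ k ih =>
    have hnot : k + 1 ∉ Finset.Icc 1 k := by simp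
    have hins : Finset.Icc 1 (k + 1) = insert (k + 1) (Finset.Icc 1 k) := by
      ext x
      simp only [Finset.mem_Icc, Finset.mem_insert]
      omega
    have hmem : ∀ Q ∈ (Finset.Icc 1 k).powerset, k + 1 ∉ Q := fun Q hQ h =>
      hnot (Finset.mem_powerset.1 hQ h)
    rw [hins, Finset.powerset_insert, Finset.filter_union, Finset.card_union_of_disjoint,
      boundedCount, ih]
    · congr 1
      rw [Finset.filter_image, Finset.card_image_of_injOn]
      · split_ifs with hle
        · rw [ih]
          congr 1
          apply Finset.filter_congr
          intro Q hQ
          rw [Finset.sum_insert (hmem Q hQ)]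
          omega
        · rw [eq_comm, Finset.card_eq_zero, Finset.filter_eq_empty_iff]
          intro Q hQ
          rw [Finset.sum_insert (hmem Q hQ)]
          omega
      · intro Q hQ Q' hQ' h
        simp only [Finset.coe_filter, Set.mem_ofPred_eq] at hQ hQ'
        rw [← Finset.erase_insert (hmem Q hQ.1), h, Finset.erase_insert (hmem Q' hQ'.1)]
    · rw [Finset.disjoint_left]
      intro Q hQ hQ'
      simp only [Finset.mem_filter, Finset.mem_image] at hQ hQ'
      obtain ⟨⟨Q', -, rfl⟩, -⟩ := hQ'
      exact hmem _ hQ.1 (Finset.mem_insert_self _ _)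

/-- Each part is at most `n`, so indices beyond `k` cannot occur; `fibo` is injective on positive
indices, so sets of numbers and sets of indices correspond. -/
theorem F_eq_boundedCount {k n : ℕ} (h : n < fibo (k + 1)) : F n = boundedCount k n := by
  classical
  have hinj : Set.InjOn fibo {i | 1 ≤ i} := fun i hi j hj h => fibo_injOn hi hj h
  rw [boundedCount_eq_card, F, ← Set.ncard_coe_finset]
  symm
  refine Set.ncard_congr (fun Q _ => Q.image fibo) ?_ ?_ ?_
  · intro Q hQ
    simp only [Finset.coe_filter, Finset.mem_powerset, Set.mem_ofPred_eq] at hQ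
    have h1 : ∀ i ∈ Q, 1 ≤ i := fun i hi => (Finset.mem_Icc.1 (hQ.1 hi)).1
    refine ⟨?_, ?_⟩
    · intro x hx
      obtain ⟨i, hi, rfl⟩ := Finset.mem_image.1 hx
      exact ⟨i, h1 i hi, rfl⟩
    · rw [Finset.sum_image (hinj.mono h1)]
      exact hQ.2
  · intro Q Q' hQ hQ' hQQ
    simp only [Finset.coe_filter, Finset.mem_powerset, Set.mem_ofPred_eq] at hQ hQ'
    have h1 : ∀ i ∈ Q, 1 ≤ i := fun i hi => (Finset.mem_Icc.1 (hQ.1 hi)).1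
    have h2 : ∀ i ∈ Q', 1 ≤ i := fun i hi => (Finset.mem_Icc.1 (hQ'.1 hi)).1
    have h3 : fibo '' (Q : Set ℕ) = fibo '' (Q' : Set ℕ) := by
      rw [← Finset.coe_image, ← Finset.coe_image, hQQ]
    exact Finset.coe_injective ((hinj.image_eq_image_iff h1 h2).1 h3)
  · intro P hP
    obtain ⟨h1, h2⟩ := hP
    have himg : ((Finset.Icc 1 k).filter (fun i => fibo i ∈ P)).image fibo = P := by
      ext x
      simp only [Finset.mem_image, Finset.mem_filter, Finset.mem_Icc]
      constructor
      · rintro ⟨i, ⟨-, hi⟩, rfl⟩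
        exact hi
      · intro hx
        obtain ⟨i, hi, rfl⟩ := h1 x hx
        refine ⟨i, ⟨⟨hi, ?_⟩, hx⟩, rfl⟩
        by_contra hik
        have h3 := fibo_mono (show k + 1 ≤ i by omega)
        have h4 : fibo i ≤ ∑ x ∈ P, x :=
          Finset.single_le_sum (f := fun x => x) (fun _ _ => Nat.zero_le _) hx
        omega
    refine ⟨(Finset.Icc 1 k).filter (fun i => fibo i ∈ P), ?_, himg⟩
    simp only [Finset.coe_filter, Finset.mem_powerset, Set.mem_ofPred_eq]
    refine ⟨Finset.filter_subset _ _, ?_⟩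
    rw [← h2]
    conv_rhs => rw [← himg]
    rw [Finset.sum_image]
    intro i hi j hj
    simp only [Finset.coe_filter, Finset.mem_Icc, Set.mem_ofPred_eq] at hi hj
    exact fibo_injOn hi.1.1 hj.1.1

/-- All available parts together give only `f_1 + ⋯ + f_k = f_{k+2} - 2`. -/
theorem boundedCount_eq_zero {k n : ℕ} (h : fibo (k + 2) ≤ n + 1) : boundedCount k n = 0 := by
  induction k generalizing n with
  | zero =>
    have : n ≠ 0 := by
      rintro rfl
      exact absurd h (by decide)
    simp [boundedCount, this]
  | succ k ih =>
    have h1 : fibo (k + 1 + 2) = fibo (k + 2) + fibo (k + 1) := fibo_add_two (k + 1)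
    rw [boundedCount, ih (by omega)]
    split_ifs
    · rw [ih (by omega)]
    · rfl

theorem boundedCount_succ_add (k m : ℕ) :
    boundedCount (k + 1) (fibo (k + 1) + m) =
      boundedCount k (fibo (k + 1) + m) + boundedCount k m := by
  rw [boundedCount, if_pos (Nat.le_add_right _ _), Nat.add_sub_cancel_left]

/-- Either index `i + 2` is used, leaving `m`, or index `i + 1` must be, since the smaller ones do
not suffice; this leaves `f_i + m`. -/
theorem boundedCount_add_two (i m : ℕ) :
    boundedCount (i + 2) (fibo (i + 2) + m) =
      boundedCount (i + 1) m + boundedCount i (fibo i + m) := by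
  have h : fibo (i + 2) + m = fibo (i + 1) + (fibo i + m) := by
    rw [fibo_add_two, add_assoc]
  have h1 : boundedCount (i + 1) (fibo (i + 2) + m) = boundedCount i (fibo i + m) := by
    rw [h, boundedCount_succ_add, ← h, boundedCount_eq_zero (by omega), zero_add]
  rw [boundedCount_succ_add, h1, add_comm]

theorem F_zero : F 0 = 1 := F_eq_boundedCount (k := 0) (by decide)

theorem boundedCount_zero_right (k : ℕ) : boundedCount k 0 = 1 := by
  rw [← F_eq_boundedCount (fibo_pos _), F_zero]

theorem boundedCount_fibo (i : ℕ) : boundedCount i (fibo i) = (i + 1) / 2 := by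
  induction i using Nat.twoStepInduction with
  | zero => rfl
  | one => rfl
  | more i ih _ =>
    have := boundedCount_add_two i 0
    rw [add_zero, add_zero, boundedCount_zero_right, ih] at this
    rw [this]
    omega

theorem F_fibo {i : ℕ} (hi : 1 ≤ i) : F (fibo i) = (i - 1) / 2 + 1 := by
  rw [F_eq_boundedCount (fibo_lt_succ hi), boundedCount_fibo]
  omega

/-! ### Adjoining a new largest part -/

section Step

variable {j m' : ℕ}

theorem fibo_add_lt (hj : 1 ≤ j) (h : m' < fibo (j - 1)) : fibo j + m' < fibo (j + 1) := by
  obtain ⟨l, rfl⟩ := Nat.exists_eq_add_of_le' hj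
  rw [fibo_add_two]
  simp only [Nat.add_sub_cancel] at h
  omega

/-- By `boundedCount_add_two`, raising the top index by 2 adds one copy of `F (fibo j + m')`. At `k
= 0` the top index must be used, which gives the first copy. -/
theorem boundedCount_odd_gap (hj : 1 ≤ j) (h : m' < fibo (j - 1)) (k : ℕ) :
    boundedCount (j + 1 + 2 * k) (fibo (j + 1 + 2 * k) + (fibo j + m')) =
      (k + 1) * F (fibo j + m') := by
  have hlt := fibo_add_lt hj h
  induction k with
  | zero =>
    rw [mul_zero, add_zero, boundedCount_succ_add, ← F_eq_boundedCount hlt,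
      boundedCount_eq_zero (by rw [fibo_add_two]; omega)]
    ring
  | succ k ih =>
    have e : j + 1 + 2 * (k + 1) = j + 1 + 2 * k + 2 := by ring
    have h2 := fibo_mono (show j + 1 ≤ j + 1 + 2 * k + 1 + 1 by omega)
    rw [e, boundedCount_add_two, ih, ← F_eq_boundedCount (lt_of_lt_of_le hlt h2)]
    ring

/-- The induction starts at the degenerate gap 0, with the sum `2 f_j + m'`. There index `j` must be
used, so what is counted are the representations of `f_j + m'` avoiding `j`; those using `j` number
`F m'`, whence the correction. -/
theorem boundedCount_even_gap (hj : 1 ≤ j) (h : m' < fibo (j - 1)) (k : ℕ) :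
    boundedCount (j + 2 * k) (fibo (j + 2 * k) + (fibo j + m')) + F m' =
      (k + 1) * F (fibo j + m') := by
  have hlt := fibo_add_lt hj h
  induction k with
  | zero =>
    obtain ⟨l, rfl⟩ := Nat.exists_eq_add_of_le' hj
    have h1 : fibo (l + 2) = fibo (l + 1) + fibo l := fibo_add_two l
    have h2 := fibo_mono (show l ≤ l + 1 by omega)
    simp only [Nat.add_sub_cancel] at h
    rw [mul_zero, add_zero, boundedCount_succ_add, boundedCount_eq_zero (by omega), zero_add,
      F_eq_boundedCount hlt, boundedCount_succ_add, F_eq_boundedCount (k := l) (by omega)]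
    ring
  | succ k ih =>
    have e : j + 2 * (k + 1) = j + 2 * k + 2 := by ring
    have h2 := fibo_mono (show j + 1 ≤ j + 2 * k + 1 + 1 by omega)
    rw [e, boundedCount_add_two, ← F_eq_boundedCount (lt_of_lt_of_le hlt h2), add_assoc, ih]
    ring

theorem fibo_add_fibo_add_lt {i : ℕ} (hj : 1 ≤ j) (h : m' < fibo (j - 1)) (hi : j + 2 ≤ i) :
    fibo i + (fibo j + m') < fibo (i + 1) := by
  have hlt := fibo_add_lt hj h
  obtain ⟨l, rfl⟩ := Nat.exists_eq_add_of_le' (show 1 ≤ i by omega)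
  have h2 := fibo_mono (show j + 1 ≤ l by omega)
  rw [fibo_add_two]
  omega

theorem F_add_of_odd_gap {i : ℕ} (hj : 1 ≤ j) (h : m' < fibo (j - 1)) (hi : j + 2 ≤ i)
    (hp : i % 2 ≠ j % 2) :
    F (fibo i + (fibo j + m')) = ((i - j) / 2 + 1) * F (fibo j + m') := by
  rw [F_eq_boundedCount (fibo_add_fibo_add_lt hj h hi), ← boundedCount_odd_gap hj h]
  have : j + 1 + 2 * ((i - j) / 2) = i := by omega
  rw [this]

theorem F_add_of_even_gap {i : ℕ} (hj : 1 ≤ j) (h : m' < fibo (j - 1)) (hi : j + 2 ≤ i)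
    (hp : i % 2 = j % 2) :
    F (fibo i + (fibo j + m')) + F m' = ((i - j) / 2 + 1) * F (fibo j + m') := by
  rw [F_eq_boundedCount (fibo_add_fibo_add_lt hj h hi), ← boundedCount_even_gap hj h]
  have : j + 2 * ((i - j) / 2) = i := by omega
  rw [this]

end Step

theorem fsum_lt_of_append {I : List ℕ} {j : ℕ} (h : IsTwoPartition (I ++ [j])) :
    fsum I < fibo (j - 1) := by
  induction I using List.reverseRecOn generalizing j with
  | nil => exact fibo_pos _
  | append_singleton I i ih =>
    have h1 : IsTwoPartition (I ++ [i]) :=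
      ⟨fun a ha => h.1 a (List.mem_append_left _ ha), (List.isChain_append.1 h.2).1⟩
    have h2 : i + 2 ≤ j := by
      have := (List.isChain_append.1 h.2).2.2
      exact this i (by simp) j (by simp)
    have h3 : 1 ≤ i := h1.1 i (by simp)
    have h4 := fibo_add_lt h3 (ih h1)
    have h5 := fibo_mono (show i + 1 ≤ j - 1 by omega)
    rw [fsum_append, fsum_cons, fsum_nil]
    omega

/-! ### Continuants -/

/-- Numerator and denominator of the continued fraction `cf`. -/
def cfPair : List ℕ → ℤ × ℤ
  | [] => (0, 1)
  | a :: A => ((cfPair A).2, a * (cfPair A).2 - (cfPair A).1)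

theorem cfPair_bounds {A : List ℕ} (h : ∀ a ∈ A, 2 ≤ a) :
    0 ≤ (cfPair A).1 ∧ (cfPair A).1 < (cfPair A).2 := by
  induction A with
  | nil => simp [cfPair]
  | cons a A ih =>
    rw [List.forall_mem_cons] at h
    obtain ⟨h1, h2⟩ := ih h.2
    have ha : (2 : ℤ) ≤ a := by exact_mod_cast h.1
    simp only [cfPair]
    constructor
    · omega
    · nlinarith

theorem isCoprime_cfPair (A : List ℕ) : IsCoprime (cfPair A).1 (cfPair A).2 := by
  induction A with
  | nil => exact isCoprime_one_right
  | cons a A ih =>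
    obtain ⟨x, y, hxy⟩ := ih
    exact ⟨y + x * a, -x, by simp only [cfPair]; linear_combination hxy⟩

theorem cf_eq_cfPair {A : List ℕ} (h : ∀ a ∈ A, 2 ≤ a) :
    cf A = (cfPair A).1 / (cfPair A).2 := by
  induction A with
  | nil => simp [cf, cfPair]
  | cons a A ih =>
    rw [List.forall_mem_cons] at h
    obtain ⟨h1, h2⟩ := cfPair_bounds h.2
    have h3 : ((cfPair A).2 : ℚ) ≠ 0 := by
      have : (cfPair A).2 ≠ 0 := by omega
      exact_mod_cast this
    rw [cf, ih h.2]
    simp only [cfPair]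
    push_cast
    rw [sub_div' h3, one_div_div]

/-- The leading entry may be 1, as in the first block of a 2-partition with lowest part 1 or 2. The
denominator stays positive and coprime to the numerator even if the fraction is no longer below 1.
-/
theorem den_cf_cons {a : ℕ} {A : List ℕ} (ha : 1 ≤ a) (h : ∀ b ∈ A, 2 ≤ b) :
    ((cf (a :: A)).den : ℤ) = a * (cfPair A).2 - (cfPair A).1 := by
  obtain ⟨h1, h2⟩ := cfPair_bounds h
  have ha' : (1 : ℤ) ≤ a := by exact_mod_cast ha
  have hpos : 0 < a * (cfPair A).2 - (cfPair A).1 := by nlinarith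
  have h3 : ((cfPair A).2 : ℚ) ≠ 0 := by
    have : (cfPair A).2 ≠ 0 := by omega
    exact_mod_cast this
  have hcf : cf (a :: A) =
      ((cfPair A).2 : ℚ) / ((a * (cfPair A).2 - (cfPair A).1 : ℤ) : ℚ) := by
    rw [cf, cf_eq_cfPair h]
    push_cast
    rw [sub_div' h3, one_div_div]
  rw [hcf]
  refine Rat.den_div_eq_of_coprime hpos ?_
  exact Int.isCoprime_iff_gcd_eq_one.1 (isCoprime_cfPair (a :: A))

/-- The gap recursion involves two previous counts, so the induction carries those of `P` with and
without `i`. Equal parity peels one entry off the continuant; a change of parity makes the count of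
`P` drop out and splits off a new block as a factor. -/
theorem F_fsum_append (P I : List ℕ) (i : ℕ) (h : IsTwoPartition (P ++ i :: I)) :
    (F (fsum (P ++ i :: I)) : ℤ) =
      (F (fsum (P ++ [i])) * (cfPair (tailBlocks i I).1).2 -
        F (fsum P) * (cfPair (tailBlocks i I).1).1) *
        ((tailBlocks i I).2.map fun B => (cfPair B).2).prod := by
  induction I generalizing P i with
  | nil => simp [tailBlocks, cfPair]
  | cons j I ih =>
    have e : P ++ i :: j :: I = (P ++ [i]) ++ j :: I := by simp
    have h1 : IsTwoPartition (P ++ [i]) := by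
      rw [e] at h
      exact ⟨fun a ha => h.1 a (List.mem_append_left _ ha), (List.isChain_append.1 h.2).1⟩
    have h2 : i + 2 ≤ j := by
      rw [e] at h
      exact (List.isChain_append.1 h.2).2.2 i (by simp) j (by simp)
    have h3 : 1 ≤ i := h1.1 i (by simp)
    have h4 := fsum_lt_of_append h1
    have e1 : fsum (P ++ [i] ++ [j]) = fibo j + (fibo i + fsum P) := by
      simp only [fsum_append, fsum_cons, fsum_nil]
      ring
    have e2 : fsum (P ++ [i]) = fibo i + fsum P := by
      simp only [fsum_append, fsum_cons, fsum_nil]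
      ring
    rw [e, ih _ _ (e ▸ h), e1, e2, tailBlocks]
    split_ifs with hp
    · have h5 := F_add_of_even_gap h3 h4 h2 hp.symm
      have h6 : (F (fibo j + (fibo i + fsum P)) : ℤ) =
          (((j - i) / 2 + 1 : ℕ) : ℤ) * F (fibo i + fsum P) - F (fsum P) := by
        rw [eq_sub_iff_add_eq]
        exact_mod_cast h5
      rw [h6]
      simp only [cfPair]
      ring
    · have h5 := F_add_of_odd_gap h3 h4 h2 (Ne.symm hp)
      have h6 : (F (fibo j + (fibo i + fsum P)) : ℤ) =
          (((j - i) / 2 + 1 : ℕ) : ℤ) * F (fibo i + fsum P) := by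
        exact_mod_cast h5
      rw [h6]
      simp only [cfPair, List.map_cons, List.prod_cons]
      ring

theorem delta_p {A : List (List ℕ)} (h : IsReduced A) :
    ((delta (p A) : ℕ) : ℤ) = (A.map fun B => (cfPair B).2).prod := by
  induction A with
  | nil => simp [p_nil]
  | cons B A ih =>
    rw [isReduced_cons] at h
    obtain ⟨b, B, rfl⟩ := List.exists_cons_of_ne_nil h.1.1
    have hB := h.1.2
    rw [List.forall_mem_cons] at hB
    rw [p_cons, map_mul, PNat.mul_coe, Nat.cast_mul, ih h.2, delta_letter,
      den_cf_cons (by omega) hB.2, List.map_cons, List.prod_cons]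
    rfl

/-- `F = δ ∘ π`. -/
theorem F_eq_delta_proj (n : ℕ) : F n = (delta (proj n) : ℕ) := by
  have hZ := isTwoPartition_Z n
  have hn := fsum_Z n
  rw [proj]
  generalize Z n = I at hZ hn
  subst hn
  cases I with
  | nil => rw [fsum_nil, F_zero, V_nil, p_nil, map_one]; rfl
  | cons i I =>
    obtain ⟨h2, h3⟩ := tailBlocks_reduced hZ
    -- With empty prefix the initial counts are `F 0 = 1` and `F (fibo i)`, the first vector entry,
    -- so the bracket is the denominator of the first fraction.
    have h4 := F_fsum_append [] I i hZ
    simp only [List.nil_append, fsum_nil, F_zero, fsum_cons i [], add_zero,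
      F_fibo hZ.head_pos] at h4
    zify
    rw [h4, V_cons, p_cons, map_mul, PNat.mul_coe, Nat.cast_mul, delta_p h3, delta_letter,
      den_cf_cons (by omega) h2]
    push_cast
    ring


/-! ### The maps `ω`, `τ`, `S` on `ℕ` -/

theorem Z_omegaN (n : ℕ) : Z (omegaN n) = omegaP (Z n) :=
  Z_fsum (isTwoPartition_omegaP (isTwoPartition_Z n))

theorem Z_tauN (n : ℕ) : Z (tauN n) = tauP (Z n) :=
  Z_fsum (isTwoPartition_tauP (isTwoPartition_Z n))

theorem Z_shiftN (n : ℕ) : Z (shiftN n) = shiftP (Z n) :=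
  Z_fsum (isTwoPartition_shiftP (isTwoPartition_Z n))

theorem Z_injective : Function.Injective Z := fun m n h => by
  rw [← fsum_Z m, h, fsum_Z]

/-- `ω` as an element of the monoid of self-maps of `ℕ`. -/
def omegaE : Function.End ℕ := omegaN

/-- `τ` as an element of the monoid of self-maps of `ℕ`. -/
def tauE : Function.End ℕ := tauN

/-- `S` as an element of the monoid of self-maps of `ℕ`. -/
def shiftE : Function.End ℕ := shiftN

theorem omegaE_mul_self : omegaE * omegaE = 1 := by
  funext n
  apply Z_injective
  change Z (omegaN (omegaN n)) = Z n
  rw [Z_omegaN, Z_omegaN, omegaP_omegaP (isTwoPartition_Z n)]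

theorem tauE_mul_self : tauE * tauE = 1 := by
  funext n
  apply Z_injective
  change Z (tauN (tauN n)) = Z n
  rw [Z_tauN, Z_tauN, tauP_tauP (isTwoPartition_Z n)]

theorem commute_omegaE_tauE : Commute omegaE tauE := by
  funext n
  apply Z_injective
  change Z (omegaN (tauN n)) = Z (tauN (omegaN n))
  rw [Z_omegaN, Z_tauN, Z_tauN, Z_omegaN, omegaP_tauP (isTwoPartition_Z n)]

theorem commute_omegaE_shiftE : Commute omegaE shiftE := by
  funext n
  apply Z_injective
  change Z (omegaN (shiftN n)) = Z (shiftN (omegaN n))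
  rw [Z_omegaN, Z_shiftN, Z_shiftN, Z_omegaN, omegaP_shiftP (isTwoPartition_Z n)]

theorem commute_tauE_shiftE : Commute tauE shiftE := by
  funext n
  apply Z_injective
  change Z (tauN (shiftN n)) = Z (shiftN (tauN n))
  rw [Z_tauN, Z_shiftN, Z_shiftN, Z_tauN, tauP_shiftP]

theorem proj_omegaN (n : ℕ) : proj (omegaN n) = proj n := by
  rw [proj, Z_omegaN, V_omegaP (isTwoPartition_Z n), proj]

theorem proj_tauN (n : ℕ) : proj (tauN n) = proj n := by
  rw [proj, Z_tauN, p_V_tauP (isTwoPartition_Z n), proj]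

theorem proj_shiftN (n : ℕ) : proj (shiftN n) = proj n := by
  rw [proj, Z_shiftN, p_V_shiftP (isTwoPartition_Z n), proj]

/-! ### The homomorphism from `ℤ₂ × ℤ₂ × ℕ` onto `T` -/

/-- The homomorphism from `ℤ/2` determined by an element of square one. -/
def involutionHom {M : Type*} [Monoid M] (x : M) (hx : x * x = 1) :
    Multiplicative (ZMod 2) →* M where
  toFun a := x ^ (Multiplicative.toAdd a).val
  map_one' := pow_zero x
  map_mul' a b := by
    have key : ∀ a b : ZMod 2, x ^ (a + b).val = x ^ a.val * x ^ b.val := by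
      intro a b
      rw [ZMod.val_add, ← pow_add]
      conv_rhs => rw [← Nat.mod_add_div (a.val + b.val) 2]
      rw [pow_add, pow_mul, pow_two, hx, one_pow, mul_one]
    exact key _ _

/-- The group `ℤ₂ × ℤ₂ × ℕ`, written multiplicatively. -/
abbrev TModel : Type := Multiplicative (ZMod 2) × Multiplicative (ZMod 2) × Multiplicative ℕ

/-- The action of `ℤ₂ × ℤ₂ × ℕ` on `ℕ` through `ω`, `τ`, `S`. -/
def toEnd : TModel →* Function.End ℕ :=
  (involutionHom omegaE omegaE_mul_self).noncommCoprod
    ((involutionHom tauE tauE_mul_self).noncommCoprod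
      (powersHom (Function.End ℕ) shiftE)
      fun _ _ => commute_tauE_shiftE.pow_pow _ _)
    fun _ _ => (commute_omegaE_tauE.pow_pow _ _).mul_right (commute_omegaE_shiftE.pow_pow _ _)

/-- This order, with `ω` acting first and `S` last, suits primitive 2-partitions: after `ω` the
lowest part is still at least 3, so `τ` is given by its explicit formula. -/
theorem toEnd_apply (a b : Multiplicative (ZMod 2)) (r : Multiplicative ℕ) :
    toEnd (a, b, r) = shiftE ^ (Multiplicative.toAdd r) *
      (tauE ^ (Multiplicative.toAdd b).val *
        omegaE ^ (Multiplicative.toAdd a).val) := by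
  have h1 := commute_omegaE_tauE.pow_pow (Multiplicative.toAdd a).val (Multiplicative.toAdd b).val
  have h2 := commute_omegaE_shiftE.pow_pow (Multiplicative.toAdd a).val (Multiplicative.toAdd r)
  have h3 := commute_tauE_shiftE.pow_pow (Multiplicative.toAdd b).val (Multiplicative.toAdd r)
  change omegaE ^ (Multiplicative.toAdd a).val *
    (tauE ^ (Multiplicative.toAdd b).val *
      shiftE ^ (Multiplicative.toAdd r)) = _
  rw [h3.eq, ← mul_assoc, h2.eq, mul_assoc, h1.eq]

theorem toEnd_omega : toEnd (Multiplicative.ofAdd 1, 1, 1) = omegaE := by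
  rw [toEnd_apply]
  change shiftE ^ 0 *
    (tauE ^ 0 * omegaE ^ 1) = _
  rw [pow_zero, pow_zero, one_mul, one_mul, pow_one]

theorem toEnd_tau : toEnd (1, Multiplicative.ofAdd 1, 1) = tauE := by
  rw [toEnd_apply]
  change shiftE ^ 0 *
    (tauE ^ 1 * omegaE ^ 0) = _
  rw [pow_zero, pow_zero, one_mul, mul_one, pow_one]

theorem toEnd_shift : toEnd (1, 1, Multiplicative.ofAdd 1) = shiftE := by
  rw [toEnd_apply]
  change shiftE ^ 1 *
    (tauE ^ 0 * omegaE ^ 0) = _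
  rw [pow_zero, pow_zero, mul_one, mul_one, pow_one]

theorem omegaE_mem : omegaE ∈ T := Submonoid.subset_closure (Or.inl rfl)

theorem tauE_mem : tauE ∈ T := Submonoid.subset_closure (Or.inr (Or.inl rfl))

theorem shiftE_mem : shiftE ∈ T := Submonoid.subset_closure (Or.inr (Or.inr rfl))

theorem toEnd_mem (x : TModel) : toEnd x ∈ T := by
  obtain ⟨a, b, r⟩ := x
  rw [toEnd_apply]
  exact mul_mem (pow_mem shiftE_mem _) (mul_mem (pow_mem tauE_mem _) (pow_mem omegaE_mem _))

theorem exists_toEnd_eq {t : Function.End ℕ} (ht : t ∈ T) : ∃ x, toEnd x = t := by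
  have h : T ≤ MonoidHom.mrange toEnd := by
    rw [T, Submonoid.closure_le]
    rintro _ (rfl | rfl | rfl)
    · exact ⟨_, toEnd_omega⟩
    · exact ⟨_, toEnd_tau⟩
    · exact ⟨_, toEnd_shift⟩
  exact h ht

theorem proj_T {t : Function.End ℕ} (ht : t ∈ T) (n : ℕ) : proj (t n) = proj n := by
  induction ht using Submonoid.closure_induction generalizing n with
  | mem t ht =>
    rcases ht with rfl | rfl | rfl
    · exact proj_omegaN n
    · exact proj_tauN n
    · exact proj_shiftN n
  | one => rfl
  | mul s t _ _ hs ht => exact (hs (t n)).trans (ht n)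

theorem Z_pow {f : Function.End ℕ} {g : List ℕ → List ℕ} (h : ∀ n, Z (f n) = g (Z n)) (k n : ℕ) :
    Z ((f ^ k) n) = g^[k] (Z n) := by
  induction k with
  | zero => rfl
  | succ k ih =>
    rw [pow_succ', Function.iterate_succ_apply', ← ih, ← h]
    rfl

theorem Z_toEnd (a b : Multiplicative (ZMod 2)) (r : Multiplicative ℕ) (n : ℕ) :
    Z (toEnd (a, b, r) n) = shiftP^[Multiplicative.toAdd r]
      (tauP^[(Multiplicative.toAdd b).val] (omegaP^[(Multiplicative.toAdd a).val] (Z n))) := by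
  rw [toEnd_apply, ← Z_pow (f := omegaE) Z_omegaN, ← Z_pow (f := tauE) Z_tauN,
    ← Z_pow (f := shiftE) Z_shiftN]
  rfl

/-! ### Freeness -/

theorem iterate_shiftP_ne_nil {I : List ℕ} (h : I ≠ []) (k : ℕ) : shiftP^[k] I ≠ [] := by
  induction k with
  | zero => exact h
  | succ k ih => rw [Function.iterate_succ_apply']; exact shiftP_ne_nil ih

theorem length_iterate_shiftP {I : List ℕ} (h : I ≠ []) (k : ℕ) :
    (shiftP^[k] I).length = I.length + k := by
  induction k with
  | zero => rfl
  | succ k ih =>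
    rw [Function.iterate_succ_apply', length_shiftP (iterate_shiftP_ne_nil h k), ih, add_assoc]

theorem headParity_iterate_shiftP (I : List ℕ) (k : ℕ) :
    headParity (shiftP^[k] I) = headParity I := by
  induction k with
  | zero => rfl
  | succ k ih => rw [Function.iterate_succ_apply', headParity_shiftP, ih]

theorem iterate_shiftP_injective {I J : List ℕ} (hI : I ≠ []) (hJ : J ≠ []) (k : ℕ)
    (h : shiftP^[k] I = shiftP^[k] J) : I = J := by
  induction k with
  | zero => exact h
  | succ k ih =>
    rw [Function.iterate_succ_apply', Function.iterate_succ_apply'] at h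
    exact ih (shiftP_injective (iterate_shiftP_ne_nil hI k) (iterate_shiftP_ne_nil hJ k) h)

theorem iterate_tauP_ne_nil {i : ℕ} (I : List ℕ) (hi : 3 ≤ i) {b : ℕ} (hb : b < 2) :
    tauP^[b] (i :: I) ≠ [] := by
  interval_cases b
  · simp
  · simp [tauP_of_three_le I hi]

theorem tau_shift_cancel_aux {i : ℕ} {I : List ℕ} (hi : 3 ≤ i) {b b' : ℕ} (hb : b < 2)
    (hb' : b' < 2) (r k : ℕ)
    (h : shiftP^[r] (tauP^[b] (i :: I)) = shiftP^[r + k] (tauP^[b'] (i :: I))) :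
    b = b' ∧ k = 0 := by
  rw [Function.iterate_add_apply] at h
  have h1 := iterate_tauP_ne_nil I hi hb
  have h2 := iterate_tauP_ne_nil I hi hb'
  have h3 := iterate_shiftP_injective h1 (iterate_shiftP_ne_nil h2 k) r h
  have h4 := congrArg List.length h3
  rw [length_iterate_shiftP h2] at h4
  interval_cases b <;> interval_cases b' <;>
    simp only [Function.iterate_zero, Function.iterate_one, id, tauP_of_three_le I hi,
      List.length_cons, List.length_map] at h3 h4
  · omega
  · omega
  -- On parts at least 3 both `τ` and `S` add one part, so lengths leave only `τ` against `S`; the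
  -- second parts `i + 1` and `i + 2` differ.
  · have hk : k = 1 := by omega
    subst hk
    simp [shiftP_cons] at h3
  · omega

theorem tau_shift_cancel {i : ℕ} {I : List ℕ} (hi : 3 ≤ i) {b b' : ℕ} (hb : b < 2)
    (hb' : b' < 2) (r r' : ℕ)
    (h : shiftP^[r] (tauP^[b] (i :: I)) = shiftP^[r'] (tauP^[b'] (i :: I))) :
    b = b' ∧ r = r' := by
  rcases le_total r r' with hr | hr
  · obtain ⟨k, rfl⟩ := Nat.exists_eq_add_of_le hr
    have := tau_shift_cancel_aux hi hb hb' r k h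
    omega
  · obtain ⟨k, rfl⟩ := Nat.exists_eq_add_of_le hr
    have := tau_shift_cancel_aux hi hb' hb r' k h.symm
    omega

/-- `τ` and `S` preserve the parity of the lowest part, so that parity determines the exponent of
`ω`. -/
theorem toEnd_free {n : ℕ} (hn : IsPrimitive (Z n)) {x y : TModel}
    (h : toEnd x n = toEnd y n) : x = y := by
  obtain ⟨a, b, r⟩ := x
  obtain ⟨a', b', r'⟩ := y
  have h1 := congrArg Z h
  rw [Z_toEnd, Z_toEnd] at h1
  obtain ⟨hI, i, I, hZ, hi, hi'⟩ := hn
  rw [hZ] at h1 hI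
  have ha := ZMod.val_lt (Multiplicative.toAdd a)
  have hb := ZMod.val_lt (Multiplicative.toAdd b)
  have ha' := ZMod.val_lt (Multiplicative.toAdd a')
  have hb' := ZMod.val_lt (Multiplicative.toAdd b')
  have key : ∀ a < 2, ∃ j J, omegaP^[a] (i :: I) = j :: J ∧ 3 ≤ j ∧ j % 2 = 1 - a := by
    intro a ha
    interval_cases a
    · exact ⟨i, I, rfl, hi, hi'⟩
    · exact ⟨i + 1, _, omegaP_odd I hi', by omega, by omega⟩
  have hpar : ∀ (j : ℕ) (J : List ℕ) (b r : ℕ), 3 ≤ j → b < 2 →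
      headParity (shiftP^[r] (tauP^[b] (j :: J))) = j % 2 := by
    intro j J b r hj hb
    rw [headParity_iterate_shiftP]
    interval_cases b
    · rfl
    · exact headParity_tauP_of_three_le J hj
  obtain ⟨j, J, hj, hj3, hjp⟩ := key _ ha
  obtain ⟨j', J', hj', hj3', hjp'⟩ := key _ ha'
  have hpp := congrArg headParity h1
  rw [hj, hj', hpar _ _ _ _ hj3 hb, hpar _ _ _ _ hj3' hb'] at hpp
  have haa : (Multiplicative.toAdd a).val = (Multiplicative.toAdd a').val := by omega
  rw [← haa, hj] at h1
  obtain ⟨h2, h3⟩ := tau_shift_cancel hj3 hb hb' _ _ h1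
  have e1 : a = a' := ZMod.val_injective 2 haa
  have e2 : b = b' := ZMod.val_injective 2 h2
  have e3 : r = r' := h3
  rw [e1, e2, e3]

/-! ### Regular numbers -/

/-- The 2-partitions `∅`, `S^k {1}`, `S^k {2}`. -/
def IsDegenerate (I : List ℕ) : Prop :=
  I = [] ∨ ∃ k, I = shiftP^[k] [1] ∨ I = shiftP^[k] [2]

theorem IsDegenerate.shiftP {I : List ℕ} (h : IsDegenerate I) :
    IsDegenerate (FibPart.shiftP I) := by
  rcases h with rfl | ⟨k, rfl | rfl⟩
  · exact Or.inl rfl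
  · exact Or.inr ⟨k + 1, Or.inl (Function.iterate_succ_apply' _ _ _).symm⟩
  · exact Or.inr ⟨k + 1, Or.inr (Function.iterate_succ_apply' _ _ _).symm⟩

theorem exists_primitive_of_three_le {i : ℕ} {I : List ℕ} (hi : 3 ≤ i)
    (h : IsTwoPartition (i :: I)) :
    ∃ x j, IsPrimitive (Z j) ∧ fsum (i :: I) = toEnd x j := by
  rcases h.odd_or_omegaP with hi' | ⟨j, J, hJ, hj, rfl, rfl⟩
  · refine ⟨1, fsum (i :: I), ?_, by rw [map_one]; rfl⟩
    rw [Z_fsum h]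
    exact ⟨h, i, I, rfl, hi, hi'⟩
  · refine ⟨(Multiplicative.ofAdd 1, 1, 1), fsum (j :: J), ?_, ?_⟩
    · rw [Z_fsum hJ]
      exact ⟨hJ, j, J, rfl, by omega, hj⟩
    · rw [toEnd_omega]
      change _ = omegaN _
      rw [omegaN, Z_fsum hJ, omegaP_odd _ hj]

theorem degenerate_or_exists_primitive {I : List ℕ} (h : IsTwoPartition I) :
    IsDegenerate I ∨ ∃ x j, IsPrimitive (Z j) ∧ fsum I = toEnd x j := by
  induction I, h using twoPartition_induction with
  | nil => exact Or.inl (Or.inl rfl)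
  | one => exact Or.inl (Or.inr ⟨0, Or.inl rfl⟩)
  | two => exact Or.inl (Or.inr ⟨0, Or.inr rfl⟩)
  | large i I hi h => exact Or.inr (exists_primitive_of_three_le hi h)
  | tau i I hi h =>
    obtain ⟨x, j, hj, hx⟩ := exists_primitive_of_three_le hi h
    refine Or.inr ⟨(1, Multiplicative.ofAdd 1, 1) * x, j, hj, ?_⟩
    rw [map_mul, toEnd_tau]
    change _ = tauN (toEnd x j)
    rw [← hx, tauN, Z_fsum h]
  | shift i I h ih =>
    rcases ih with ih | ⟨x, j, hj, hx⟩
    · exact Or.inl ih.shiftP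
    · refine Or.inr ⟨(1, 1, Multiplicative.ofAdd 1) * x, j, hj, ?_⟩
      rw [map_mul, toEnd_shift]
      change _ = shiftN (toEnd x j)
      rw [← hx, shiftN, Z_fsum h]

theorem isTwoPartition_iterate_shiftP {I : List ℕ} (h : IsTwoPartition I) (k : ℕ) :
    IsTwoPartition (shiftP^[k] I) := by
  induction k with
  | zero => exact h
  | succ k ih => rw [Function.iterate_succ_apply']; exact isTwoPartition_shiftP ih

theorem p_V_iterate_shiftP {I : List ℕ} (h : IsTwoPartition I) (k : ℕ) :
    p (V (shiftP^[k] I)) = p (V I) := by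
  induction k with
  | zero => rfl
  | succ k ih =>
    rw [Function.iterate_succ_apply', p_V_shiftP (isTwoPartition_iterate_shiftP h k), ih]

theorem IsDegenerate.p_V {I : List ℕ} (h : IsDegenerate I) : p (V I) = 1 := by
  have h1 : cf [0 + 1] = 1 := by simp [cf]
  rcases h with rfl | ⟨k, rfl | rfl⟩
  · rfl
  · rw [p_V_iterate_shiftP (isTwoPartition_singleton.2 le_rfl), V_cons]
    simp only [tailBlocks, p_cons, p_nil, mul_one]
    exact (congrArg letter h1).trans letter_one
  · rw [p_V_iterate_shiftP (isTwoPartition_singleton.2 one_le_two), V_cons]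
    simp only [tailBlocks, p_cons, p_nil, mul_one]
    exact (congrArg letter h1).trans letter_one

theorem sum_map_shiftP {I : List ℕ} (h : I ≠ []) (m : ℕ) :
    ((shiftP I).map fun i => fibo (i + m)).sum =
      fibo (2 - headParity I + m) + (I.map fun i => fibo (i + (m + 2))).sum := by
  obtain ⟨i, I, rfl⟩ := List.exists_cons_of_ne_nil h
  simp only [shiftP_cons, headParity, List.headD_cons, List.map_cons, List.map_map, List.sum_cons,
    Function.comp_def, add_assoc, add_comm 2 m]

/-- The sum `f_1 + f_3 + ⋯ + f_{2k+1}` telescopes. The offset `m` is needed because `S` translates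
the old parts by 2 before adding a new one. -/
theorem sum_iterate_shiftP_one (k m : ℕ) :
    ((shiftP^[k] [1]).map fun i => fibo (i + m)).sum + fibo m = fibo (2 * k + 2 + m) := by
  induction k generalizing m with
  | zero =>
    have := fibo_add_two m
    simp only [Function.iterate_zero, id, List.map_cons, List.map_nil, List.sum_cons,
      List.sum_nil, add_zero, mul_zero, zero_add, add_comm 1 m, add_comm 2 m]
    exact this.symm
  | succ k ih =>
    have h1 := fibo_add_two m
    have h2 := ih (m + 2)
    have h3 : headParity [1] = 1 := rfl
    have h4 : 2 - 1 + m = m + 1 := by omega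
    have h5 : 2 * (k + 1) + 2 + m = 2 * k + 2 + (m + 2) := by ring
    rw [Function.iterate_succ_apply', sum_map_shiftP (iterate_shiftP_ne_nil (by simp) k),
      headParity_iterate_shiftP, h3, h4, h5, ← h2]
    omega

theorem sum_iterate_shiftP_two (k m : ℕ) :
    ((shiftP^[k] [2]).map fun i => fibo (i + m)).sum + fibo (m + 1) = fibo (2 * k + 3 + m) := by
  induction k generalizing m with
  | zero =>
    have := fibo_add_two (m + 1)
    simp only [Function.iterate_zero, id, List.map_cons, List.map_nil, List.sum_cons,
      List.sum_nil, add_zero, mul_zero, zero_add, add_comm 2 m, add_comm 3 m]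
    exact this.symm
  | succ k ih =>
    have h1 : fibo (m + 2 + 1) = fibo (m + 2) + fibo (m + 1) := fibo_add_two (m + 1)
    have h2 := ih (m + 2)
    have h3 : headParity [2] = 0 := rfl
    have h4 : 2 - 0 + m = m + 2 := by omega
    have h5 : 2 * (k + 1) + 3 + m = 2 * k + 3 + (m + 2) := by ring
    rw [Function.iterate_succ_apply', sum_map_shiftP (iterate_shiftP_ne_nil (by simp) k),
      headParity_iterate_shiftP, h3, h4, h5, ← h2]
    omega

theorem fsum_iterate_shiftP_one (k : ℕ) : fsum (shiftP^[k] [1]) + 1 = fibo (2 * k + 2) :=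
  sum_iterate_shiftP_one k 0

theorem fsum_iterate_shiftP_two (k : ℕ) : fsum (shiftP^[k] [2]) + 1 = fibo (2 * k + 3) :=
  sum_iterate_shiftP_two k 0

theorem Z_zero : Z 0 = [] := Z_fsum isTwoPartition_nil

theorem isDegenerate_Z_iff (n : ℕ) : IsDegenerate (Z n) ↔ ¬ Regular n := by
  simp only [Regular, not_forall, not_not]
  constructor
  · have hn := fsum_Z n
    rintro (h | ⟨k, h | h⟩) <;> rw [h] at hn
    · exact ⟨1, le_rfl, by rw [← hn]; rfl⟩
    · exact ⟨2 * k + 2, by omega, by rw [← hn, fsum_iterate_shiftP_one]⟩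
    · exact ⟨2 * k + 3, by omega, by rw [← hn, fsum_iterate_shiftP_two]⟩
  · rintro ⟨r, hr, h⟩
    -- `r = 1` gives `∅`, even `r` gives `S^k {1}`, and odd `r ≥ 3` gives `S^k {2}`.
    rcases hr.eq_or_lt with rfl | hr
    · rw [fibo_one] at h
      have : n = 0 := by omega
      subst this
      exact Or.inl Z_zero
    rcases Nat.even_or_odd' (r - 2) with ⟨k, hk | hk⟩
    · refine Or.inr ⟨k, Or.inl ?_⟩
      have h1 : r = 2 * k + 2 := by omega
      rw [h1, ← fsum_iterate_shiftP_one, Nat.add_right_cancel_iff] at h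
      rw [h, Z_fsum (isTwoPartition_iterate_shiftP (isTwoPartition_singleton.2 le_rfl) k)]
    · refine Or.inr ⟨k, Or.inr ?_⟩
      have h1 : r = 2 * k + 3 := by omega
      rw [h1, ← fsum_iterate_shiftP_two, Nat.add_right_cancel_iff] at h
      rw [h, Z_fsum (isTwoPartition_iterate_shiftP (isTwoPartition_singleton.2 one_le_two) k)]

theorem Regular.exists_primitive {n : ℕ} (h : Regular n) :
    ∃ x j, IsPrimitive (Z j) ∧ n = toEnd x j := by
  rcases degenerate_or_exists_primitive (isTwoPartition_Z n) with h1 | h1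
  · exact absurd h ((isDegenerate_Z_iff n).1 h1)
  · rwa [fsum_Z] at h1

theorem IsPrimitive.proj_ne_one {n : ℕ} (h : IsPrimitive (Z n)) : proj n ≠ 1 := by
  refine p_ne_one h.isReduced_V ?_
  obtain ⟨-, i, I, hZ, -⟩ := h
  rw [hZ, V_cons]
  simp

theorem proj_toEnd (x : TModel) (n : ℕ) : proj (toEnd x n) = proj n := proj_T (toEnd_mem x) n

theorem proj_eq_one_iff (n : ℕ) : proj n = 1 ↔ ¬ Regular n := by
  constructor
  · intro h hn
    obtain ⟨x, j, hj, rfl⟩ := hn.exists_primitive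
    rw [proj_toEnd] at h
    exact hj.proj_ne_one h
  · intro h
    exact ((isDegenerate_Z_iff n).2 h).p_V

theorem IsPrimitive.eq_of_proj_eq {m n : ℕ} (hm : IsPrimitive (Z m)) (hn : IsPrimitive (Z n))
    (h : proj m = proj n) : m = n :=
  Z_injective (hm.V_injective hn (p_injective hm.isReduced_V hn.isReduced_V h))

/-! ### The map `θ` -/

theorem exists_isTheta (γ : Gam) : ∃ n, IsTheta (c γ) n := by
  by_cases h : γ = 1
  · subst h
    refine ⟨0, ?_, ?_⟩
    · rw [Z_zero]
      rfl
    · simp [Z_zero]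
  · obtain ⟨I, hI, hV⟩ := exists_isPrimitive_V_eq (isReduced_c γ) (c_ne_nil h)
    refine ⟨fsum I, ?_⟩
    rw [IsTheta, Z_fsum hI.1]
    refine ⟨hV, ?_⟩
    obtain ⟨-, i, I, rfl, -, hi⟩ := hI
    simpa [Nat.odd_iff] using hi

theorem isTheta_theta (γ : Gam) : IsTheta (c γ) (theta γ) :=
  Nat.sInf_mem (s := {n | IsTheta (c γ) n}) (exists_isTheta γ)

theorem proj_theta (γ : Gam) : proj (theta γ) = γ := by
  rw [proj, (isTheta_theta γ).1, p_c]

theorem isPrimitive_theta {γ : Gam} (h : γ ≠ 1) : IsPrimitive (Z (theta γ)) := by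
  obtain ⟨h1, h2⟩ := isTheta_theta γ
  refine ⟨isTwoPartition_Z _, ?_⟩
  have h3 := isReduced_c γ
  have h4 := c_ne_nil h
  rw [← h1] at h3 h4
  generalize Z (theta γ) = I at h2 h3 h4
  cases I with
  | nil => exact absurd V_nil h4
  | cons i I =>
    have h5 : i % 2 = 1 := Nat.odd_iff.1 (h2 i (by simp))
    rw [V_cons, isReduced_cons] at h3
    have h6 := h3.1.2 _ List.mem_cons_self
    exact ⟨i, I, rfl, by omega, h5⟩

theorem theta_one : theta 1 = 0 := by
  have h1 := (isTheta_theta 1).1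
  have h2 : c 1 = [] := rfl
  rw [h2] at h1
  rw [← fsum_Z (theta 1)]
  generalize Z (theta 1) = I at h1
  cases I with
  | nil => rfl
  | cons i I => rw [V_cons] at h1; simp at h1

theorem exists_toEnd_theta {n : ℕ} (h : Regular n) : ∃ x, n = toEnd x (theta (proj n)) := by
  have hne : proj n ≠ 1 := fun h' => (proj_eq_one_iff n).1 h' h
  obtain ⟨x, j, hj, hn⟩ := h.exists_primitive
  have hp : proj n = proj j := by rw [hn, proj_toEnd]
  have : j = theta (proj n) :=
    hj.eq_of_proj_eq (isPrimitive_theta hne) (by rw [proj_theta, hp])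
  exact ⟨x, this ▸ hn⟩

theorem sum_map_fibo_le (k : ℕ) (I : List ℕ) : fsum I ≤ fsum (I.map (· + k)) := by
  induction I with
  | nil => exact le_rfl
  | cons i I ih =>
    rw [List.map_cons, fsum_cons, fsum_cons]
    have := fibo_mono (Nat.le_add_right i k)
    omega

theorem fsum_le_fsum_shiftP (I : List ℕ) : fsum I ≤ fsum (shiftP I) := by
  cases I with
  | nil => exact le_rfl
  | cons i I =>
    have := sum_map_fibo_le 2 (i :: I)
    rw [shiftP, fsum_cons (2 - i % 2)]
    omega

theorem fsum_le_fsum_iterate_shiftP (k : ℕ) (I : List ℕ) : fsum I ≤ fsum (shiftP^[k] I) := by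
  induction k with
  | zero => exact le_rfl
  | succ k ih =>
    rw [Function.iterate_succ_apply']
    exact ih.trans (fsum_le_fsum_shiftP _)

theorem fsum_le_fsum_tauP_of_three_le {i : ℕ} (I : List ℕ) (hi : 3 ≤ i) :
    fsum (i :: I) ≤ fsum (tauP (i :: I)) := by
  have := sum_map_fibo_le 1 (i :: I)
  rw [tauP_of_three_le I hi, fsum_cons (2 - i % 2), ← List.map_cons (f := (· + 1))]
  omega

/-- On a primitive 2-partition `ω` moves parts upwards since the lowest one is odd, `τ` inserts a
part since the lowest is at least 3, and `S` always increases the sum. -/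
theorem IsPrimitive.le_toEnd {n : ℕ} (h : IsPrimitive (Z n)) (x : TModel) : n ≤ toEnd x n := by
  obtain ⟨a, b, r⟩ := x
  rw [← fsum_Z (toEnd (a, b, r) n), Z_toEnd]
  conv_lhs => rw [← fsum_Z n]
  obtain ⟨-, i, I, hZ, hi, hi'⟩ := h
  rw [hZ]
  refine le_trans ?_ (fsum_le_fsum_iterate_shiftP _ _)
  have ha := ZMod.val_lt (Multiplicative.toAdd a)
  have hb := ZMod.val_lt (Multiplicative.toAdd b)
  have h1 : ∃ j J, omegaP^[(Multiplicative.toAdd a).val] (i :: I) = j :: J ∧ 3 ≤ j ∧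
      fsum (i :: I) ≤ fsum (j :: J) := by
    generalize (Multiplicative.toAdd a).val = a at ha
    interval_cases a
    · exact ⟨i, I, rfl, hi, le_rfl⟩
    · exact ⟨i + 1, _, omegaP_odd I hi', by omega, sum_map_fibo_le 1 (i :: I)⟩
  obtain ⟨j, J, hj, hj3, hle⟩ := h1
  rw [hj]
  refine hle.trans ?_
  generalize (Multiplicative.toAdd b).val = b at hb
  interval_cases b
  · exact le_rfl
  · exact fsum_le_fsum_tauP_of_three_le J hj3

theorem isLeast_theta (γ : Gam) : IsLeast {n | proj n = γ} (theta γ) := by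
  refine ⟨proj_theta γ, ?_⟩
  rintro n rfl
  by_cases h : Regular n
  · obtain ⟨x, hx⟩ := exists_toEnd_theta h
    have hne : proj n ≠ 1 := fun h' => (proj_eq_one_iff n).1 h' h
    calc theta (proj n) ≤ toEnd x (theta (proj n)) := (isPrimitive_theta hne).le_toEnd x
      _ = n := hx.symm
  · rw [(proj_eq_one_iff n).2 h, theta_one]
    exact Nat.zero_le n

/-! ### Orbits -/

theorem proj_smul (t : T) (n : ℕ) : proj (t • n) = proj n := proj_T t.2 n

theorem proj_eq_of_mem_orbitClass {m n : ℕ} (h : m ∈ orbitClass n) : proj m = proj n := by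
  have h' : Relation.EqvGen (fun a b => ∃ t : T, t • a = b) n m := h
  induction h' with
  | rel a b hab =>
    obtain ⟨t, rfl⟩ := hab
    exact proj_smul t a
  | refl a => rfl
  | symm a b hab ih => exact (ih hab).symm
  | trans a b d hab hbd ih1 ih2 => exact (ih2 hbd).trans (ih1 hab)

theorem regular_iff (n : ℕ) : Regular n ↔ proj n ≠ 1 := by
  rw [Ne, proj_eq_one_iff, not_not]

theorem mem_orbit_theta {n : ℕ} (h : Regular n) : n ∈ MulAction.orbit T (theta (proj n)) := by
  obtain ⟨x, hx⟩ := exists_toEnd_theta h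
  exact ⟨⟨toEnd x, toEnd_mem x⟩, hx.symm⟩

/-- `T` is not a group, so equivalence classes need not be forward orbits. They are here because a
class stays in one fibre of `proj` and every regular number of the fibre is reached from its
`theta`. -/
theorem orbitClass_eq {n : ℕ} (h : Regular n) :
    orbitClass n = MulAction.orbit T (theta (proj n)) := by
  ext m
  constructor
  · intro hm
    have hp := proj_eq_of_mem_orbitClass hm
    rw [← hp]
    apply mem_orbit_theta
    rw [regular_iff, hp]
    exact (regular_iff n).1 h
  · rintro ⟨t, rfl⟩
    obtain ⟨s, hs⟩ := mem_orbit_theta h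
    exact ((Relation.EqvGen.rel _ _ ⟨s, hs⟩).symm _ _).trans _ _ _ (Relation.EqvGen.rel _ _ ⟨t, rfl⟩)

theorem orbit_theta_injective :
    Function.Injective fun γ : Gam => MulAction.orbit T (theta γ) := by
  intro γ γ' h
  have h1 : theta γ ∈ MulAction.orbit T (theta γ') := by
    rw [← show MulAction.orbit T (theta γ) = MulAction.orbit T (theta γ') from h]
    exact ⟨1, one_smul _ _⟩
  obtain ⟨t, ht⟩ := h1
  rw [← proj_theta γ, ← proj_theta γ', ← proj_smul t (theta γ')]
  exact congrArg proj ht.symm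

theorem regular_theta {γ : Gam} (h : γ ≠ 1) : Regular (theta γ) := by
  rwa [regular_iff, proj_theta]

theorem toEnd_injOn_regular {n : ℕ} (hn : Regular n) {x y : TModel}
    (h : toEnd x n = toEnd y n) : x = y := by
  obtain ⟨u, j, hj, rfl⟩ := hn.exists_primitive
  -- Freeness at the primitive `j` transfers to `n = u j` because `ℤ₂ × ℤ₂ × ℕ` is cancellative.
  have h1 : toEnd (x * u) j = toEnd (y * u) j := by
    rw [map_mul, map_mul]
    exact h
  exact mul_right_cancel (toEnd_free hj h1)

/-- Freeness yields injectivity of `toEnd` only if some regular point exists. -/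
theorem exists_regular : ∃ n, Regular n := by
  refine ⟨theta (letter (1 / 2)), regular_theta ?_⟩
  rw [letter_of_mem (by norm_num) (by norm_num)]
  exact FreeMonoid.of_ne_one _

theorem toEnd_injective : Function.Injective toEnd := by
  obtain ⟨n, hn⟩ := exists_regular
  intro x y h
  exact toEnd_injOn_regular hn (congrFun h n)

/-- The isomorphism `ℤ₂ × ℤ₂ × ℕ ≅ T`. -/
noncomputable def equivT : TModel ≃* T :=
  MulEquiv.ofBijective (toEnd.codRestrict T toEnd_mem) ⟨fun x y h =>
    toEnd_injective (congrArg Subtype.val h), fun t => by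
      obtain ⟨x, hx⟩ := exists_toEnd_eq t.2
      exact ⟨x, Subtype.ext hx⟩⟩

theorem smul_free {n : ℕ} (hn : Regular n) (s t : T) (h : s • n = t • n) : s = t := by
  obtain ⟨x, rfl⟩ := equivT.surjective s
  obtain ⟨y, rfl⟩ := equivT.surjective t
  rw [toEnd_injOn_regular hn (x := x) (y := y) h]

end FibPart

theorem theorem2p5 :
    -- `T ≅ ℤ₂ × ℤ₂ × ℕ`, with `ω`, `τ`, `S` as the standard generators
    (∃ e : Multiplicative (ZMod 2) × Multiplicative (ZMod 2) × Multiplicative ℕ ≃* T,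
      (e (Multiplicative.ofAdd 1, 1, 1) : Function.End ℕ) = omegaN ∧
      (e (1, Multiplicative.ofAdd 1, 1) : Function.End ℕ) = tauN ∧
      (e (1, 1, Multiplicative.ofAdd 1) : Function.End ℕ) = shiftN) ∧
    -- the action is free at the regular numbers
    (∀ n, Regular n → ∀ s t : T, s • n = t • n → s = t) ∧
    -- `θ(γ)` has multivector `c(γ)` and odd lowest part, and is the least element of `π⁻¹(γ)`
    (∀ γ : Gam, IsTheta (c γ) (theta γ) ∧ IsLeast {n | proj n = γ} (theta γ)) ∧
    -- each regular orbit is `T θ(γ)` for a unique `γ`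
    (∀ n, Regular n → ∃! γ : Gam, orbitClass n = MulAction.orbit T (theta γ)) ∧
    -- this is a bijection between the regular orbits and the non-unit elements of `Γ(ℚ/ℤ)`
    Set.BijOn (fun γ : Gam => MulAction.orbit T (theta γ))
      {γ | γ ≠ 1} (orbitClass '' {n | Regular n}) ∧
    -- the natural projection is `π = p ∘ V ∘ Z`
    (∀ n, Regular n → orbitClass n = MulAction.orbit T (theta (proj n))) ∧
    -- the fibre of `π` over the unit consists of the numbers `f_r - 1`
    (∀ n, proj n = 1 ↔ ¬ Regular n) ∧
    -- `F` and `π` are invariant, and `F = δ ∘ π`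
    (∀ (t : T) (n : ℕ), proj (t • n) = proj n ∧ F (t • n) = F n) ∧
    (∀ n, F n = (delta (proj n) : ℕ)) := by
  refine ⟨⟨equivT, toEnd_omega, toEnd_tau, toEnd_shift⟩, fun n hn s t => smul_free hn s t,
    fun γ => ⟨isTheta_theta γ, isLeast_theta γ⟩, ?_, ⟨?_, orbit_theta_injective.injOn, ?_⟩,
    fun n hn => orbitClass_eq hn, proj_eq_one_iff, ?_, F_eq_delta_proj⟩
  · intro n hn
    refine ⟨proj n, orbitClass_eq hn, fun γ hγ => ?_⟩
    exact orbit_theta_injective (hγ.symm.trans (orbitClass_eq hn))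
  · intro γ hγ
    refine ⟨theta γ, regular_theta hγ, ?_⟩
    rw [orbitClass_eq (regular_theta hγ), proj_theta]
  · rintro _ ⟨n, hn, rfl⟩
    exact ⟨proj n, (regular_iff n).1 hn, (orbitClass_eq hn).symm⟩
  · intro t n
    refine ⟨proj_smul t n, ?_⟩
    rw [F_eq_delta_proj, F_eq_delta_proj, proj_smul]
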